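/- Let $n\ge 1$, let $\mathcal H\in C^1(\mathbb S^n)$, and let $\Sigma$ be an $\mathcal H$-hypersurface in $\mathbb R^{n+1}$: an immersed hypersurface of class $C^3$ (without boundary), oriented by a continuous unit normal $\eta:\Sigma\to\mathbb S^n$, whose mean curvature (the arithmetic mean of the principal curvatures, normalized so that the unit sphere with its inner normal has mean curvature $1$) is $\mathcal H\circ\eta$. Let $f\in C^2_0(\Sigma)$ be a compactly supported function of class $C^2$, and for $t\in\mathbb R$ consider the normal variation $$\Sigma_t:\quad p\in\Sigma\mapsto p+t f(p)\eta(p).$$ Then there is $\varepsilon>0$ such that for $|t|<\varepsilon$ this is an immersed hypersurface of class $C^2$, with a unique unit normal $\eta^t:\Sigma\to\mathbb S^n$ compatible with the orientation that $\eta$ induces on $\Sigma$. Let $H(t)$ be the mean curvature of $\Sigma_t$ with respect to $\eta^t$ and let $\hat{\mathcal H}(t):=H(t)-\mathcal H(\eta^t)$, a function on $\Sigma$ for each $|t|<\varepsilon$. Then at every point of $\Sigma$ the function $t\mapsto\hat{\mathcal H}(t)$ is differentiable at $t=0$, and $$n\,\hat{\mathcal H}'(0)=\mathcal L f,\qquad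 \mathcal L f:=\Delta f+\langle X_{\mathcal H},\nabla f\rangle+|\sigma|^2 f .$$ Here $X_{\mathcal H}$ is the tangent vector field on $\Sigma$ given by $X_{\mathcal H}(p):=n\,\nabla_{\mathbb S}\mathcal H(\eta(p))$, where $\nabla_{\mathbb S}$ is the gradient on $\mathbb S^n$, and $\Delta$, $\nabla$, $|\sigma|$ are the Laplacian, the gradient and the norm of the second fundamental form of $\Sigma$ with its induced metric. -/

import Mathlib

open scoped Manifold ContDiff RealInnerProductSpace

noncomputable section

namespace HHyp

/-- The ambient Euclidean space `ℝⁿ⁺¹`. -/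
abbrev Amb (n : ℕ) : Type := EuclideanSpace ℝ (Fin (n + 1))

/-- The unit sphere `𝕊ⁿ ⊂ ℝⁿ⁺¹`, with Mathlib's manifold structure. -/
abbrev Sph (n : ℕ) : Type := Metric.sphere (0 : Amb n) 1

section Parametrized

/-! ### Classical local formulas for a parametrized hypersurface

Here `X` is a parametrization with parameters in (an open part of) `ℝⁿ`, `u` is a parameter value,
`φ` is a scalar function of the parameters and `N` is the unit normal vector at `u`. -/

variable {n : ℕ}

/-- Partial derivative `∂ᵢ F`. -/
def pd {V : Type*} [NormedAddCommGroup V] [NormedSpace ℝ V] (i : Fin n)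
    (F : EuclideanSpace ℝ (Fin n) → V) (u : EuclideanSpace ℝ (Fin n)) : V :=
  fderiv ℝ F u (EuclideanSpace.single i 1)

/-- First fundamental form (induced metric) `gᵢⱼ = ⟨∂ᵢX, ∂ⱼX⟩`. -/
def firstFF (X : EuclideanSpace ℝ (Fin n) → Amb n) (u : EuclideanSpace ℝ (Fin n)) :
    Matrix (Fin n) (Fin n) ℝ :=
  Matrix.of fun i j => ⟪pd i X u, pd j X u⟫

/-- The inverse metric `gⁱʲ`. -/
def invFF (X : EuclideanSpace ℝ (Fin n) → Amb n) (u : EuclideanSpace ℝ (Fin n)) :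
    Matrix (Fin n) (Fin n) ℝ :=
  (firstFF X u)⁻¹

/-- Second fundamental form `hᵢⱼ = ⟨∂ᵢ∂ⱼX, N⟩`. -/
def secondFF (X : EuclideanSpace ℝ (Fin n) → Amb n) (N : Amb n)
    (u : EuclideanSpace ℝ (Fin n)) : Matrix (Fin n) (Fin n) ℝ :=
  Matrix.of fun i j => ⟪pd i (pd j X) u, N⟫

/-- Christoffel symbols `Γᵏᵢⱼ = ½ ∑ₗ gᵏˡ (∂ᵢgⱼₗ + ∂ⱼgᵢₗ - ∂ₗgᵢⱼ)` of the induced metric. -/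
def christoffel (X : EuclideanSpace ℝ (Fin n) → Amb n) (k i j : Fin n)
    (u : EuclideanSpace ℝ (Fin n)) : ℝ :=
  (1 / 2) * ∑ l, invFF X u k l *
    (pd i (fun w => firstFF X w j l) u + pd j (fun w => firstFF X w i l) u
      - pd l (fun w => firstFF X w i j) u)

/-- Gradient for the induced metric, as a vector of `ℝⁿ⁺¹` tangent to the hypersurface:
`∇φ = ∑ᵢⱼ gⁱʲ ∂ⱼφ ∂ᵢX`. -/
def gradLoc (X : EuclideanSpace ℝ (Fin n) → Amb n) (φ : EuclideanSpace ℝ (Fin n) → ℝ)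
    (u : EuclideanSpace ℝ (Fin n)) : Amb n :=
  ∑ i, ∑ j, (invFF X u i j * pd j φ u) • pd i X u

/-- Laplace-Beltrami operator of the induced metric, the trace of the Hessian:
`Δφ = ∑ᵢⱼ gⁱʲ (∂ᵢ∂ⱼφ - ∑ₖ Γᵏᵢⱼ ∂ₖφ)`. -/
def laplaceLoc (X : EuclideanSpace ℝ (Fin n) → Amb n) (φ : EuclideanSpace ℝ (Fin n) → ℝ)
    (u : EuclideanSpace ℝ (Fin n)) : ℝ :=
  ∑ i, ∑ j, invFF X u i j * (pd i (pd j φ) u - ∑ k, christoffel X k i j u * pd k φ u)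

/-- Mean curvature `H = (1/n) ∑ᵢⱼ gⁱʲ hᵢⱼ`, the arithmetic mean of the principal curvatures. -/
def meanCurvLoc (X : EuclideanSpace ℝ (Fin n) → Amb n) (N : Amb n)
    (u : EuclideanSpace ℝ (Fin n)) : ℝ :=
  (1 / (n : ℝ)) * ∑ i, ∑ j, invFF X u i j * secondFF X N u i j

/-- Squared norm of the second fundamental form, `|σ|² = ∑ gⁱʲ gᵏˡ hᵢₖ hⱼₗ`. -/
def sqNormSecondFFLoc (X : EuclideanSpace ℝ (Fin n) → Amb n) (N : Amb n)
    (u : EuclideanSpace ℝ (Fin n)) : ℝ :=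
  ∑ i, ∑ j, ∑ k, ∑ l,
    invFF X u i j * invFF X u k l * secondFF X N u i k * secondFF X N u j l

end Parametrized

section Hypersurface

/-! ### Immersed oriented hypersurfaces `ψ : M → ℝⁿ⁺¹` with unit normal `η : M → 𝕊ⁿ`

The geometric quantities at `p` are computed in the preferred chart of `M` at `p`; by tensoriality
their values do not depend on the chart. -/

variable {n : ℕ} {M : Type*} [TopologicalSpace M] [ChartedSpace (EuclideanSpace ℝ (Fin n)) M]

/-- A map on `M` read in the preferred chart at `p`. -/
def inChart {V : Type*} (F : M → V) (p : M) : EuclideanSpace ℝ (Fin n) → V :=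
  fun u => F ((extChartAt (𝓡 n) p).symm u)

/-- The coordinates of `p` in the preferred chart at `p`. -/
def coordAt (p : M) : EuclideanSpace ℝ (Fin n) := extChartAt (𝓡 n) p p

/-- The gradient `∇f` of a function on the hypersurface `ψ`, for the induced metric, seen as a
vector of `ℝⁿ⁺¹` through `dψ`. For the inclusion of `𝕊ⁿ` it is the spherical gradient. -/
def grad (ψ : M → Amb n) (f : M → ℝ) (p : M) : Amb n :=
  gradLoc (inChart ψ p) (inChart f p) (coordAt p)

/-- The Laplacian `Δf` of a function on the hypersurface `ψ`, for the induced metric. -/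
def laplacian (ψ : M → Amb n) (f : M → ℝ) (p : M) : ℝ :=
  laplaceLoc (inChart ψ p) (inChart f p) (coordAt p)

/-- The mean curvature of `ψ` with respect to the unit normal `η`; it equals `1` for the unit
sphere with its inner normal. -/
def meanCurvature (ψ : M → Amb n) (η : M → Sph n) (p : M) : ℝ :=
  meanCurvLoc (inChart ψ p) (η p : Amb n) (coordAt p)

/-- The squared norm `|σ|²` of the second fundamental form of `ψ`. -/
def sqNormSecondFF (ψ : M → Amb n) (η : M → Sph n) (p : M) : ℝ :=
  sqNormSecondFFLoc (inChart ψ p) (η p : Amb n) (coordAt p)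

/-- `ψ : M → ℝⁿ⁺¹` is an immersed hypersurface of class `C^k`, oriented by the
(continuous) unit normal `η : M → 𝕊ⁿ`. -/
structure IsOrientedHypersurface (k : ℕ∞) (ψ : M → Amb n) (η : M → Sph n) : Prop where
  contMDiff : ContMDiff (𝓡 n) 𝓘(ℝ, Amb n) k ψ
  immersion : ∀ p, Function.Injective (mvfderiv (𝓡 n) ψ p)
  normal : ∀ (p : M) (v : TangentSpace (𝓡 n) p), ⟪(η p : Amb n), mvfderiv (𝓡 n) ψ p v⟫ = 0
  continuous_normal : Continuous η

/-- An `𝓗`-hypersurface: its mean curvature is `𝓗 ∘ η`. The regularity `C³` is the one for which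
`η` is of class `C²`, so that normal variations are of class `C²`. -/
structure IsHHypersurface (𝓗 : Sph n → ℝ) (ψ : M → Amb n) (η : M → Sph n) : Prop where
  oriented : IsOrientedHypersurface 3 ψ η
  prescribed : ∀ p, meanCurvature ψ η p = 𝓗 (η p)

/-- `det (dψ(v₁), …, dψ(vₙ), η(p))`, in the canonical basis of `ℝⁿ⁺¹`. -/
def frameDet (ψ : M → Amb n) (η : M → Sph n) (p : M) (v : Fin n → TangentSpace (𝓡 n) p) : ℝ :=
  (EuclideanSpace.basisFun (Fin (n + 1)) ℝ).toBasis.det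
    (Fin.snoc (α := fun _ => Amb n) (fun i => mvfderiv (𝓡 n) ψ p (v i)) (η p : Amb n))

/-- The unit normals `η` of `ψ` and `ν` of `φ` induce the same orientation of `M`. -/
def SameOrientation (ψ : M → Amb n) (η : M → Sph n) (φ : M → Amb n) (ν : M → Sph n) : Prop :=
  ∀ (p : M) (v : Fin n → TangentSpace (𝓡 n) p), LinearIndependent ℝ v →
    0 < frameDet ψ η p v * frameDet φ ν p v

/-- The normal variation `p ↦ ψ(p) + t f(p) η(p)`. -/
def normalVariation (ψ : M → Amb n) (η : M → Sph n) (f : M → ℝ) (t : ℝ) : M → Amb n :=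
  fun p => ψ p + (t * f p) • (η p : Amb n)

/-- The normal variation at time `t` is an immersed hypersurface (of class `C²`), and `ν` is its
unit normal, for the orientation that `M` has from `(ψ, η)`. -/
def IsVariationNormal (ψ : M → Amb n) (η : M → Sph n) (f : M → ℝ) (t : ℝ) (ν : M → Sph n) : Prop :=
  IsOrientedHypersurface 2 (normalVariation ψ η f t) ν ∧
    SameOrientation ψ η (normalVariation ψ η f t) ν

/-- The vector field `X_𝓗(p) = n ∇_𝕊 𝓗 (η(p))`. -/
def fieldX (𝓗 : Sph n → ℝ) (η : M → Sph n) (p : M) : Amb n :=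
  (n : ℝ) • grad (M := Sph n) Subtype.val 𝓗 (η p)

/-- The operator `𝓛 f = Δf + ⟨X_𝓗, ∇f⟩ + |σ|² f`. -/
def stabilityOp (𝓗 : Sph n → ℝ) (ψ : M → Amb n) (η : M → Sph n) (f : M → ℝ) (p : M) : ℝ :=
  laplacian ψ f p + ⟪fieldX 𝓗 η p, grad ψ f p⟫ + sqNormSecondFF ψ η p * f p

end Hypersurface

end HHyp

end

/-! Write `X`, `N`, `φ` for `ψ`, `η`, `f` in the chart at a point, `g` and `h` for the two
fundamental forms, and `Y t = X + tφN`. The first and second partial derivatives of `Y t` are affine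
in `t`, so everything reduces to derivatives at `t = 0` of finite sums of inner products.

The Weingarten equation gives `g' = -2φh`, hence `(g⁻¹)' = 2φ g⁻¹hg⁻¹` (`hasDerivAt_matrix_inv`).
Differentiating the unit length and the orthogonality relations of the normal gives `ν' = -∇φ`
(`deriv_normal_variation`). Then `h'` is the Hessian of `φ` minus `φ⟨∂ᵢN, ∂ⱼN⟩`; the Christoffel
terms come from pairing `∂ᵢ∂ⱼX` with `-∇φ`. Taking traces, `nH' = 2φ|σ|² + Δφ - φ|σ|² = Δφ + |σ|²φ`
(`hasDerivAt_meanCurvLoc`). By the chain rule on the sphere (`hasDerivAt_comp_curve`), `𝓗` along the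
moving normal has derivative `-⟨∇𝓗, ∇f⟩`; subtracting it yields the drift term.

The regularity and existence claims rest on one formula: the normal on a prescribed side is the
normalized cross product of a frame (`eq_unitNormal`), a smooth function of the frame. This makes
`η` of class `C²`, makes the varied normal exist, be unique and continuous, and makes it
differentiable in `t`. A uniform `ε` comes from compactness of the support of `f`, since
independence of the frame is an open condition. -/

open scoped Manifold ContDiff RealInnerProductSpace

namespace HHyp

/-! ### Cross products, oriented unit normals and determinants of frames. -/

section Cross

variable {n : ℕ}

/-- The determinant of `n + 1` vectors of `ℝⁿ⁺¹`, the last one singled out. -/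
noncomputable def detSnoc (w : Fin n → Amb n) (x : Amb n) : ℝ :=
  (EuclideanSpace.basisFun (Fin (n + 1)) ℝ).toBasis.det (Fin.snoc (α := fun _ => Amb n) w x)

theorem detSnoc_add (w : Fin n → Amb n) (x y : Amb n) :
    detSnoc w (x + y) = detSnoc w x + detSnoc w y := by
  have h := (EuclideanSpace.basisFun (Fin (n + 1)) ℝ).toBasis.det.map_update_add
    (Fin.snoc (α := fun _ => Amb n) w 0) (Fin.last n) x y
  simpa [Fin.update_snoc_last, detSnoc] using h

theorem detSnoc_smul (w : Fin n → Amb n) (c : ℝ) (x : Amb n) :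
    detSnoc w (c • x) = c * detSnoc w x := by
  have h := (EuclideanSpace.basisFun (Fin (n + 1)) ℝ).toBasis.det.map_update_smul
    (Fin.snoc (α := fun _ => Amb n) w 0) (Fin.last n) c x
  simpa [Fin.update_snoc_last, detSnoc] using h

/-- `detSnoc` as a linear form in the last vector. -/
noncomputable def detSnocLin (w : Fin n → Amb n) : Amb n →ₗ[ℝ] ℝ where
  toFun := detSnoc w
  map_add' := detSnoc_add w
  map_smul' := detSnoc_smul w

/-- The cross product of `n` vectors of `ℝⁿ⁺¹`. -/
noncomputable def cross (w : Fin n → Amb n) : Amb n :=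
  ∑ k, detSnoc w (EuclideanSpace.single k 1) • EuclideanSpace.single k (1 : ℝ)

/-- The cross product is the Riesz vector of the determinant as a linear form in its last entry, so
metric facts about it become facts about determinants. -/
theorem inner_cross (w : Fin n → Amb n) (x : Amb n) : ⟪x, cross w⟫ = detSnoc w x := by
  have hx : x = ∑ k, x k • EuclideanSpace.single k (1 : ℝ) := by
    have := (EuclideanSpace.basisFun (Fin (n + 1)) ℝ).sum_repr x
    simpa using this.symm
  have h1 : detSnoc w x = ∑ k, x k * detSnoc w (EuclideanSpace.single k 1) := by
    conv_lhs => rw [hx]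
    change detSnocLin w _ = _
    rw [map_sum]
    refine Finset.sum_congr rfl fun k _ => ?_
    rw [map_smul]; rfl
  rw [h1, cross, inner_sum]
  refine Finset.sum_congr rfl fun k _ => ?_
  rw [inner_smul_right, EuclideanSpace.inner_single_right]
  simp [mul_comm]

theorem detSnoc_self (w : Fin n → Amb n) (i : Fin n) : detSnoc w (w i) = 0 := by
  refine (EuclideanSpace.basisFun (Fin (n + 1)) ℝ).toBasis.det.map_eq_zero_of_eq _
    (i := i.castSucc) (j := Fin.last n) ?_ (Fin.castSucc_lt_last i).ne
  simp

theorem inner_cross_self (w : Fin n → Amb n) (i : Fin n) : ⟪w i, cross w⟫ = 0 := by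
  rw [inner_cross, detSnoc_self]

theorem detSnoc_ne_zero_iff (w : Fin n → Amb n) (x : Amb n) :
    detSnoc w x ≠ 0 ↔ LinearIndependent ℝ (Fin.snoc (α := fun _ => Amb n) w x) := by
  rw [detSnoc, ← isUnit_iff_ne_zero, ← Module.Basis.is_basis_iff_det]
  refine ⟨fun h => h.1, fun h => ⟨h, ?_⟩⟩
  exact h.span_eq_top_of_card_eq_finrank' (by simp)

theorem exists_unit_orth (w : Fin n → Amb n) : ∃ x : Amb n, ‖x‖ = 1 ∧ ∀ i, ⟪x, w i⟫ = 0 := by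
  have hlt : Module.finrank ℝ (Submodule.span ℝ (Set.range w)) < Module.finrank ℝ (Amb n) := by
    refine lt_of_le_of_lt (finrank_range_le_card w) ?_
    simp
  have hne : (Submodule.span ℝ (Set.range w))ᗮ ≠ ⊥ := by
    intro h
    rw [Submodule.orthogonal_eq_bot_iff] at h
    rw [h, finrank_top] at hlt
    exact lt_irrefl _ hlt
  obtain ⟨y, hy, hy0⟩ := Submodule.exists_mem_ne_zero_of_ne_bot hne
  refine ⟨(‖y‖)⁻¹ • y, norm_smul_inv_norm (𝕜 := ℝ) hy0, fun i => ?_⟩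
  rw [inner_smul_left, (Submodule.mem_orthogonal' _ _).1 hy _ (Submodule.subset_span ⟨i, rfl⟩),
    mul_zero]

theorem detSnoc_ne_zero_of_orth {w : Fin n → Amb n} (hw : LinearIndependent ℝ w) {x : Amb n}
    (hx : x ≠ 0) (hxw : ∀ i, ⟪x, w i⟫ = 0) : detSnoc w x ≠ 0 := by
  rw [detSnoc_ne_zero_iff, linearIndependent_finSnoc]
  refine ⟨hw, fun hmem => hx ?_⟩
  have : x ∈ (Submodule.span ℝ (Set.range w))ᗮ := by
    rw [Submodule.mem_orthogonal']
    intro u hu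
    induction hu using Submodule.span_induction with
    | mem u hu => obtain ⟨i, rfl⟩ := hu; exact hxw i
    | zero => simp
    | add u v _ _ hu hv => rw [inner_add_right, hu, hv, add_zero]
    | smul c u _ hu => rw [inner_smul_right, hu, mul_zero]
  exact inner_self_eq_zero.1 ((Submodule.mem_orthogonal' _ _).1 this x hmem)

/-- A unit vector orthogonal to the frame completes it to a basis, so its product with the cross
product is a nonzero determinant. -/
theorem cross_ne_zero {w : Fin n → Amb n} (hw : LinearIndependent ℝ w) : cross w ≠ 0 := by
  obtain ⟨x, hx, hxw⟩ := exists_unit_orth w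
  have h := detSnoc_ne_zero_of_orth hw (by rintro rfl; simp at hx) hxw
  rw [← inner_cross] at h
  rintro h0
  simp [h0] at h

theorem linearIndependent_of_detSnoc_ne_zero {w : Fin n → Amb n} {x : Amb n}
    (h : detSnoc w x ≠ 0) : LinearIndependent ℝ w :=
  (linearIndependent_finSnoc.1 ((detSnoc_ne_zero_iff w x).1 h)).1

theorem linearIndependent_of_cross_ne_zero {w : Fin n → Amb n} (h : cross w ≠ 0) :
    LinearIndependent ℝ w := by
  refine linearIndependent_of_detSnoc_ne_zero (x := cross w) ?_
  rw [← inner_cross]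
  simpa using h

/-- A vector orthogonal to `n` independent vectors and to a nonzero normal vanishes. -/
theorem eq_zero_of_orth {w : Fin n → Amb n} (hw : LinearIndependent ℝ w) {ν x : Amb n}
    (hν : ν ≠ 0) (hνw : ∀ i, ⟪ν, w i⟫ = 0) (hxw : ∀ i, ⟪x, w i⟫ = 0) (hx : ⟪x, ν⟫ = 0) :
    x = 0 := by
  have hli := (detSnoc_ne_zero_iff w ν).1 (detSnoc_ne_zero_of_orth hw hν hνw)
  have hspan := hli.span_eq_top_of_card_eq_finrank' (by simp)
  have : x ∈ (Submodule.span ℝ (Set.range (Fin.snoc (α := fun _ => Amb n) w ν)))ᗮ := by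
    rw [Submodule.mem_orthogonal']
    intro u hu
    induction hu using Submodule.span_induction with
    | mem u hu =>
      obtain ⟨i, rfl⟩ := hu
      induction i using Fin.lastCases with
      | last => simpa using hx
      | cast i => simpa using hxw i
    | zero => simp
    | add u v _ _ hu hv => rw [inner_add_right, hu, hv, add_zero]
    | smul c u _ hu => rw [inner_smul_right, hu, mul_zero]
  rw [hspan, Submodule.top_orthogonal_eq_bot] at this
  simpa using this

theorem eq_smul_cross {w : Fin n → Amb n} (hw : LinearIndependent ℝ w) {x : Amb n}
    (hxw : ∀ i, ⟪x, w i⟫ = 0) : x = (⟪x, cross w⟫ / ⟪cross w, cross w⟫) • cross w := by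
  have hc := cross_ne_zero hw
  have hc' : ⟪cross w, cross w⟫ ≠ 0 := by simpa using hc
  have hcw : ∀ i, ⟪cross w, w i⟫ = 0 := fun i => by rw [real_inner_comm, inner_cross_self]
  refine sub_eq_zero.1 (eq_zero_of_orth hw hc hcw (fun i => ?_) ?_)
  · rw [inner_sub_left, inner_smul_left, hxw, hcw, mul_zero, sub_zero]
  · rw [inner_sub_left, inner_smul_left]
    simp only [conj_trivial]
    field_simp
    ring

/-- The unit normal on the side prescribed by the sign of `s`. -/
noncomputable def unitNormal (s : ℝ) (w : Fin n → Amb n) : Amb n :=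
  ‖s • cross w‖⁻¹ • s • cross w

theorem norm_unitNormal {s : ℝ} (hs : s ≠ 0) {w : Fin n → Amb n} (hw : LinearIndependent ℝ w) :
    ‖unitNormal s w‖ = 1 :=
  norm_smul_inv_norm (𝕜 := ℝ) (smul_ne_zero hs (cross_ne_zero hw))

theorem inner_unitNormal (s : ℝ) (w : Fin n → Amb n) (i : Fin n) : ⟪unitNormal s w, w i⟫ = 0 := by
  rw [unitNormal, inner_smul_left, inner_smul_left, real_inner_comm, inner_cross_self]
  simp

theorem mul_detSnoc_unitNormal_pos {s : ℝ} (hs : s ≠ 0) {w : Fin n → Amb n}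
    (hw : LinearIndependent ℝ w) : 0 < s * detSnoc w (unitNormal s w) := by
  have hc := cross_ne_zero hw
  rw [← inner_cross, unitNormal, inner_smul_left, inner_smul_left, real_inner_self_eq_norm_sq]
  simp only [conj_trivial]
  have h1 : 0 < ‖s • cross w‖ := norm_pos_iff.2 (smul_ne_zero hs hc)
  have h2 : 0 < ‖cross w‖ := norm_pos_iff.2 hc
  have h3 : 0 < s * s := mul_self_pos.2 hs
  have : s * (‖s • cross w‖⁻¹ * (s * ‖cross w‖ ^ 2)) =
    (s * s) * (‖s • cross w‖⁻¹ * ‖cross w‖ ^ 2) := by ring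
  rw [this]
  positivity

/-- Orthogonality forces `ν = a • cross w`, unit length fixes `|a|`, and the determinant condition
gives `a` the sign of `s`. This is the source of both uniqueness and regularity of normals. -/
theorem eq_unitNormal {w : Fin n → Amb n} {ν : Amb n} {s : ℝ} (hν : ‖ν‖ = 1)
    (hνw : ∀ i, ⟪ν, w i⟫ = 0) (hs : 0 < s * detSnoc w ν) : ν = unitNormal s w := by
  have hw : LinearIndependent ℝ w :=
    linearIndependent_of_detSnoc_ne_zero (x := ν) (by rintro h; simp [h] at hs)
  have h := eq_smul_cross hw hνw
  set a := ⟪ν, cross w⟫ / ⟪cross w, cross w⟫ with ha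
  have hc : 0 < ‖cross w‖ := norm_pos_iff.2 (cross_ne_zero hw)
  have hsa : 0 < s * a := by
    rw [ha, inner_cross, real_inner_self_eq_norm_sq, ← mul_div_assoc]
    positivity
  have hna : |a| * ‖cross w‖ = 1 := by
    rw [← hν, h, norm_smul, Real.norm_eq_abs]
  have hs0 : s ≠ 0 := by rintro rfl; simp at hsa
  rw [h, unitNormal, norm_smul, Real.norm_eq_abs, smul_smul]
  congr 1
  have hinv : ‖cross w‖ = |a|⁻¹ := by
    exact eq_inv_of_mul_eq_one_right hna
  rw [hinv]
  rcases lt_or_gt_of_ne hs0 with hneg | hpos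
  · have : a < 0 := by nlinarith
    rw [abs_of_neg hneg, abs_of_neg this]
    field_simp
  · have : 0 < a := by nlinarith
    rw [abs_of_pos hpos, abs_of_pos this]
    field_simp

/-- By the Leibniz expansion the determinant is a polynomial in the coordinates. -/
theorem contDiff_detSnoc {k : ℕ∞ω} : ContDiff ℝ k fun w : (Fin n → Amb n) × Amb n =>
    detSnoc w.1 w.2 := by
  have : (fun w : (Fin n → Amb n) × Amb n => detSnoc w.1 w.2) = fun w =>
      ∑ σ : Equiv.Perm (Fin (n + 1)), (Equiv.Perm.sign σ : ℝ) *
        ∏ i, (Fin.snoc (α := fun _ => Amb n) w.1 w.2 : Fin (n + 1) → Amb n) i (σ i) := by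
    ext w
    rw [detSnoc, Module.Basis.det_apply, Matrix.det_apply']
    rfl
  rw [this]
  refine ContDiff.sum fun σ _ => contDiff_const.mul (contDiff_prod fun i _ => ?_)
  induction i using Fin.lastCases with
  | last => simp only [Fin.snoc_last]; fun_prop
  | cast i => simp only [Fin.snoc_castSucc]; fun_prop

theorem contDiff_cross {k : ℕ∞ω} : ContDiff ℝ k (cross : (Fin n → Amb n) → Amb n) := by
  unfold cross
  exact ContDiff.sum fun i _ =>
    (contDiff_detSnoc.comp (contDiff_id.prodMk contDiff_const)).fun_smul contDiff_const

theorem contDiffAt_unitNormal {k : ℕ∞ω} {s : ℝ} (hs : s ≠ 0) {w : Fin n → Amb n}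
    (hw : LinearIndependent ℝ w) :
    ContDiffAt ℝ k (fun a : ℝ × (Fin n → Amb n) => unitNormal a.1 a.2) (s, w) := by
  have h : ContDiffAt ℝ k (fun a : ℝ × (Fin n → Amb n) => a.1 • cross a.2) (s, w) :=
    contDiffAt_fst.fun_smul (contDiff_cross.contDiffAt.comp (s, w) contDiffAt_snd)
  have h0 : s • cross w ≠ 0 := smul_ne_zero hs (cross_ne_zero hw)
  exact ((h.norm ℝ h0).inv (norm_ne_zero_iff.2 h0)).fun_smul h

theorem continuousAt_detSnoc {α : Type*} [TopologicalSpace α] {w : α → Fin n → Amb n}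
    {x : α → Amb n} {a : α} (hw : ContinuousAt w a) (hx : ContinuousAt x a) :
    ContinuousAt (fun b => detSnoc (w b) (x b)) a := by
  have hg : Continuous fun y : (Fin n → Amb n) × Amb n => detSnoc y.1 y.2 :=
    (contDiff_detSnoc (k := 0)).continuous
  have hf : ContinuousAt (fun b => (w b, x b)) a := hw.prodMk hx
  have h : ContinuousAt
      ((fun y : (Fin n → Amb n) × Amb n => detSnoc y.1 y.2) ∘ fun b => (w b, x b)) a :=
    ContinuousAt.comp hg.continuousAt hf
  exact h

theorem continuousAt_unitNormal {α : Type*} [TopologicalSpace α] {s : α → ℝ}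
    {w : α → Fin n → Amb n} {a : α} (hs : ContinuousAt s a) (hw : ContinuousAt w a)
    (hs0 : s a ≠ 0) (hli : LinearIndependent ℝ (w a)) :
    ContinuousAt (fun b => unitNormal (s b) (w b)) a := by
  have hg : ContinuousAt (fun y : ℝ × (Fin n → Amb n) => unitNormal y.1 y.2) (s a, w a) :=
    (contDiffAt_unitNormal (k := 0) hs0 hli).continuousAt
  have hf : ContinuousAt (fun b => (s b, w b)) a := hs.prodMk hw
  have h : ContinuousAt
      ((fun y : ℝ × (Fin n → Amb n) => unitNormal y.1 y.2) ∘ fun b => (s b, w b)) a :=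
    ContinuousAt.comp hg hf
  exact h

theorem differentiableAt_unitNormal {s : ℝ} (hs : s ≠ 0) {w : ℝ → Fin n → Amb n} {t : ℝ}
    (hw : DifferentiableAt ℝ w t) (hli : LinearIndependent ℝ (w t)) :
    DifferentiableAt ℝ (fun r => unitNormal s (w r)) t := by
  have hg : DifferentiableAt ℝ (fun y : ℝ × (Fin n → Amb n) => unitNormal y.1 y.2) (s, w t) :=
    (contDiffAt_unitNormal (k := 1) hs hli).differentiableAt (by norm_num)
  have hf : DifferentiableAt ℝ (fun r => (s, w r)) t := (differentiableAt_const s).prodMk hw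
  have h : DifferentiableAt ℝ
      ((fun y : ℝ × (Fin n → Amb n) => unitNormal y.1 y.2) ∘ fun r => (s, w r)) t :=
    DifferentiableAt.comp t hg hf
  exact h

theorem snoc_comp_update {T : Type*} [AddCommGroup T] [Module ℝ T] (L : T →ₗ[ℝ] Amb n)
    (x : Amb n) (v : Fin n → T) (i : Fin n) (a : T) :
    (Fin.snoc (α := fun _ => Amb n) (fun j => L (Function.update v i a j)) x) =
      Function.update (Fin.snoc (α := fun _ => Amb n) (fun j => L (v j)) x) i.castSucc (L a) := by
  rw [← Fin.snoc_update]
  congr 1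
  ext1 j
  rw [Function.apply_update fun _ => L]

/-- `det (L v₁, …, L vₙ, x)` as an alternating form in the `vᵢ`. -/
noncomputable def detForm {T : Type*} [AddCommGroup T] [Module ℝ T] (L : T →ₗ[ℝ] Amb n)
    (x : Amb n) : T [⋀^Fin n]→ₗ[ℝ] ℝ where
  toFun v := detSnoc (fun i => L (v i)) x
  map_update_add' v i a b := by
    -- The structure field quantifies over all decidability instances; this replaces the given one
    -- by the instance occurring in `snoc_comp_update`.
    cases Subsingleton.elim ‹DecidableEq (Fin n)› (instDecidableEqFin n)
    simp only [detSnoc, snoc_comp_update, map_add]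
    exact AlternatingMap.map_update_add _ _ _ _ _
  map_update_smul' v i c a := by
    cases Subsingleton.elim ‹DecidableEq (Fin n)› (instDecidableEqFin n)
    simp only [detSnoc, snoc_comp_update, map_smul]
    exact AlternatingMap.map_update_smul _ _ _ _ _
  map_eq_zero_of_eq' v i j hij hne := by
    refine AlternatingMap.map_eq_zero_of_eq _ _ (i := i.castSucc) (j := j.castSucc) ?_ ?_
    · simp [hij]
    · simpa using hne

theorem detForm_apply {T : Type*} [AddCommGroup T] [Module ℝ T] (L : T →ₗ[ℝ] Amb n)
    (x : Amb n) (v : Fin n → T) : detForm L x v = detSnoc (fun i => L (v i)) x := rfl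

/-- The sign of a product of two determinants does not depend on the basis. -/
theorem detSnoc_mul_detSnoc_pos {T : Type*} [AddCommGroup T] [Module ℝ T]
    (e : Module.Basis (Fin n) ℝ T) {L L' : T →ₗ[ℝ] Amb n} {x x' : Amb n}
    (h : 0 < detSnoc (fun i => L (e i)) x * detSnoc (fun i => L' (e i)) x')
    {v : Fin n → T} (hv : LinearIndependent ℝ v) :
    0 < detSnoc (fun i => L (v i)) x * detSnoc (fun i => L' (v i)) x' := by
  -- Both determinants are alternating `n`-forms in `v`, so each is its value at `e` times `e.det
  -- v`; their product only gains the positive factor `(e.det v)²`.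
  have h1 := congrArg (fun F => F v) ((detForm L x).eq_smul_basis_det e)
  have h2 := congrArg (fun F => F v) ((detForm L' x').eq_smul_basis_det e)
  simp only [AlternatingMap.smul_apply, smul_eq_mul] at h1 h2
  rw [← detForm_apply, ← detForm_apply, h1, h2, detForm_apply, detForm_apply]
  have hd : e.det v ≠ 0 := by
    have : FiniteDimensional ℝ T := e.finiteDimensional_of_finite
    refine IsUnit.ne_zero (((Module.Basis.is_basis_iff_det e).1 ⟨hv, ?_⟩))
    exact hv.span_eq_top_of_card_eq_finrank' (by simp [Module.finrank_eq_card_basis e])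
  have := mul_pos h (mul_self_pos.2 hd)
  linarith

end Cross

/-! ### Gram matrices and expansion of vectors in a frame. -/

section Gram

variable {n : ℕ}

/-- The Gram matrix of a frame. -/
noncomputable def gramMat (w : Fin n → Amb n) : Matrix (Fin n) (Fin n) ℝ :=
  Matrix.of fun i j => ⟪w i, w j⟫

theorem det_gramMat_ne_zero {w : Fin n → Amb n} (hw : LinearIndependent ℝ w) :
    (gramMat w).det ≠ 0 :=
  (Matrix.posDef_gram_of_linearIndependent (𝕜 := ℝ) hw).det_pos.ne'

theorem gramMat_transpose (w : Fin n → Amb n) : (gramMat w).transpose = gramMat w := by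
  ext i j
  simp [gramMat, real_inner_comm]

theorem gramMat_inv_symm (w : Fin n → Amb n) (i j : Fin n) :
    (gramMat w)⁻¹ i j = (gramMat w)⁻¹ j i := by
  have := congrArg (fun A => A j i) (Matrix.transpose_nonsing_inv (gramMat w))
  rw [gramMat_transpose] at this
  simpa using this

theorem sum_gramMat_inv_mul {w : Fin n → Amb n} (hw : LinearIndependent ℝ w) (i k : Fin n) :
    ∑ j, (gramMat w)⁻¹ i j * ⟪w j, w k⟫ = if i = k then 1 else 0 := by
  have := congrArg (fun A => A i k)
    (Matrix.nonsing_inv_mul (gramMat w) (isUnit_iff_ne_zero.2 (det_gramMat_ne_zero hw)))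
  simpa [Matrix.mul_apply, Matrix.one_apply, gramMat] using this

/-- The inner product of a tangent combination with the frame. -/
theorem inner_sum_gramMat_inv {w : Fin n → Amb n} (hw : LinearIndependent ℝ w) (a : Fin n → ℝ)
    (k : Fin n) : ⟪∑ i, ∑ j, ((gramMat w)⁻¹ i j * a j) • w i, w k⟫ = a k := by
  simp only [sum_inner, inner_smul_left, conj_trivial]
  rw [Finset.sum_comm]
  have : ∀ j, ∑ i, (gramMat w)⁻¹ i j * a j * ⟪w i, w k⟫ = a j * if j = k then 1 else 0 := by
    intro j
    rw [← sum_gramMat_inv_mul hw j k, Finset.mul_sum]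
    refine Finset.sum_congr rfl fun i _ => ?_
    rw [gramMat_inv_symm w i j]; ring
  simp [this]

/-- A vector orthogonal to the normal is recovered from its products with the frame. -/
theorem eq_sum_gramMat_inv {w : Fin n → Amb n} (hw : LinearIndependent ℝ w) {ν x : Amb n}
    (hν : ν ≠ 0) (hνw : ∀ i, ⟪ν, w i⟫ = 0) (hx : ⟪x, ν⟫ = 0) :
    x = ∑ i, ∑ j, ((gramMat w)⁻¹ i j * ⟪x, w j⟫) • w i := by
  refine sub_eq_zero.1 (eq_zero_of_orth hw hν hνw (fun k => ?_) ?_)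
  · rw [inner_sub_left, inner_sum_gramMat_inv hw, sub_self]
  · rw [inner_sub_left, hx]
    simp [sum_inner, inner_smul_left, real_inner_comm, hνw]

theorem inner_eq_sum_gramMat_inv {w : Fin n → Amb n} (hw : LinearIndependent ℝ w) {ν x : Amb n}
    (hν : ν ≠ 0) (hνw : ∀ i, ⟪ν, w i⟫ = 0) (hx : ⟪x, ν⟫ = 0) (y : Amb n) :
    ⟪x, y⟫ = ∑ i, ∑ j, (gramMat w)⁻¹ i j * ⟪x, w j⟫ * ⟪w i, y⟫ := by
  conv_lhs => rw [eq_sum_gramMat_inv hw hν hνw hx]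
  simp [sum_inner, inner_smul_left]

theorem mem_span_of_orth {w : Fin n → Amb n} (hw : LinearIndependent ℝ w) {ν x : Amb n}
    (hν : ν ≠ 0) (hνw : ∀ i, ⟪ν, w i⟫ = 0) (hx : ⟪x, ν⟫ = 0) :
    x ∈ Submodule.span ℝ (Set.range w) := by
  rw [eq_sum_gramMat_inv hw hν hνw hx]
  exact Submodule.sum_mem _ fun i _ => Submodule.sum_mem _ fun j _ =>
    Submodule.smul_mem _ _ (Submodule.subset_span ⟨i, rfl⟩)

end Gram

/-! ### Differentiating an inverse matrix. -/

section InverseMatrix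

/-- Derivative of the inverse of a differentiable family of matrices, entrywise. -/
theorem hasDerivAt_matrix_inv {m : Type*} [Fintype m] [DecidableEq m] {G : ℝ → Matrix m m ℝ}
    {G' : Matrix m m ℝ} {t : ℝ} (hG : ∀ i j, HasDerivAt (fun s => G s i j) (G' i j) t)
    (h0 : (G t).det ≠ 0) (i j : m) :
    HasDerivAt (fun s => (G s)⁻¹ i j) ((-((G t)⁻¹ * G' * (G t)⁻¹)) i j) t := by
  have hGc : ContinuousAt G t := by
    refine continuousAt_pi.2 fun i => continuousAt_pi.2 fun j => (hG i j).continuousAt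
  have hdet : ContinuousAt (fun s => (G s).det) t :=
    (continuous_id.matrix_det (n := m) (R := ℝ)).continuousAt.comp hGc
  have hadj : ContinuousAt (fun s => (G s).adjugate) t :=
    (continuous_id.matrix_adjugate (n := m) (R := ℝ)).continuousAt.comp hGc
  have hinv : ContinuousAt (fun s => (G s)⁻¹) t := by
    simp only [Matrix.inv_def, Ring.inverse_eq_inv']
    exact (hdet.inv₀ h0).smul hadj
  rw [hasDerivAt_iff_tendsto_slope]
  have hne : ∀ᶠ s in nhds t, (G s).det ≠ 0 := hdet.eventually_ne h0
  have hsl : Filter.Tendsto (fun s => Matrix.of fun i j => slope (fun s => G s i j) t s)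
      (nhdsWithin t {t}ᶜ) (nhds G') :=
    tendsto_pi_nhds.2 fun i => tendsto_pi_nhds.2 fun j => (hasDerivAt_iff_tendsto_slope.1 (hG i j))
  have hlim : Filter.Tendsto (fun s => -((G s)⁻¹ *
      (Matrix.of fun i j => slope (fun s => G s i j) t s) * (G t)⁻¹))
      (nhdsWithin t {t}ᶜ) (nhds (-((G t)⁻¹ * G' * (G t)⁻¹))) :=
    (((hinv.tendsto.mono_left nhdsWithin_le_nhds).mul hsl).mul tendsto_const_nhds).neg
  have hlim' := tendsto_pi_nhds.1 (tendsto_pi_nhds.1 hlim i) j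
  refine hlim'.congr' ?_
  filter_upwards [hne.filter_mono nhdsWithin_le_nhds] with s hs
  -- Dividing this identity by `s - t` expresses the slope of the inverse through the slope of `G`,
  -- so only continuity of the inverse is needed to pass to the limit.
  have hkey : (G s)⁻¹ - (G t)⁻¹ = -((G s)⁻¹ * (G s - G t) * (G t)⁻¹) := by
    rw [mul_sub, sub_mul, Matrix.nonsing_inv_mul _ (isUnit_iff_ne_zero.2 hs), mul_assoc _ (G t),
      Matrix.mul_nonsing_inv _ (isUnit_iff_ne_zero.2 h0)]
    simp
  have hsm : (Matrix.of fun i j => slope (fun s => G s i j) t s) = (s - t)⁻¹ • (G s - G t) := by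
    ext i j
    simp [slope_def_module]
  rw [hsm, slope_def_module, ← Matrix.sub_apply, hkey]
  simp

end InverseMatrix

/-! ### Calculus of partial derivatives. -/

section PartialDerivatives

variable {n : ℕ} {V : Type*} [NormedAddCommGroup V] [NormedSpace ℝ V]
  {u : EuclideanSpace ℝ (Fin n)}

theorem contDiffAt_pd {k m : ℕ∞ω} {F : EuclideanSpace ℝ (Fin n) → V} (hF : ContDiffAt ℝ m F u)
    (hk : k + 1 ≤ m) (i : Fin n) : ContDiffAt ℝ k (pd i F) u :=
  (hF.fderiv_right hk).clm_apply contDiffAt_const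

theorem pd_congr {F G : EuclideanSpace ℝ (Fin n) → V} (h : F =ᶠ[nhds u] G) (i : Fin n) :
    pd i F u = pd i G u := by
  rw [pd, pd, h.fderiv_eq]

theorem pd_const (c : V) (i : Fin n) : pd i (fun _ => c) u = 0 := by
  simp [pd]

theorem pd_add {F G : EuclideanSpace ℝ (Fin n) → V} (hF : DifferentiableAt ℝ F u)
    (hG : DifferentiableAt ℝ G u) (i : Fin n) :
    pd i (fun w => F w + G w) u = pd i F u + pd i G u := by
  simp [pd, fderiv_fun_add hF hG]

theorem pd_smul {c : EuclideanSpace ℝ (Fin n) → ℝ} {F : EuclideanSpace ℝ (Fin n) → V}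
    (hc : DifferentiableAt ℝ c u) (hF : DifferentiableAt ℝ F u) (i : Fin n) :
    pd i (fun w => c w • F w) u = pd i c u • F u + c u • pd i F u := by
  simp [pd, fderiv_fun_smul hc hF, add_comm]

theorem pd_const_smul {F : EuclideanSpace ℝ (Fin n) → V} (c : ℝ)
    (hF : DifferentiableAt ℝ F u) (i : Fin n) :
    pd i (fun w => c • F w) u = c • pd i F u := by
  simp [pd, fderiv_fun_const_smul hF]

theorem pd_inner {F G : EuclideanSpace ℝ (Fin n) → Amb n} (hF : DifferentiableAt ℝ F u)
    (hG : DifferentiableAt ℝ G u) (i : Fin n) :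
    pd i (fun w => ⟪F w, G w⟫) u = ⟪F u, pd i G u⟫ + ⟪pd i F u, G u⟫ := by
  simp [pd, fderiv_inner_apply ℝ hF hG]

theorem pd_comm {F : EuclideanSpace ℝ (Fin n) → V} (hF : ContDiffAt ℝ 2 F u) (i j : Fin n) :
    pd i (pd j F) u = pd j (pd i F) u := by
  have hd : DifferentiableAt ℝ (fderiv ℝ F) u :=
    (hF.fderiv_right (m := 1) (by norm_num)).differentiableAt (by norm_num)
  have h : ∀ a b : Fin n, pd a (pd b F) u =
      fderiv ℝ (fderiv ℝ F) u (EuclideanSpace.single a 1) (EuclideanSpace.single b 1) := by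
    intro a b
    have : HasFDerivAt (pd b F) _ u :=
      hd.hasFDerivAt.clm_apply (hasFDerivAt_const (EuclideanSpace.single b (1 : ℝ)) u)
    rw [pd, this.fderiv]
    simp
  rw [h, h]
  exact (hF.isSymmSndFDerivAt (by simp)).eq _ _

theorem eventually_differentiableAt {F : EuclideanSpace ℝ (Fin n) → V}
    (hF : ContDiffAt ℝ 2 F u) : ∀ᶠ w in nhds u, DifferentiableAt ℝ F w :=
  (hF.eventually (by norm_num)).mono fun _ hw => hw.differentiableAt (by norm_num)

theorem differentiableAt_pd {F : EuclideanSpace ℝ (Fin n) → V}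
    (hF : ContDiffAt ℝ 2 F u) (i : Fin n) : DifferentiableAt ℝ (pd i F) u :=
  (contDiffAt_pd hF (k := 1) (by norm_num) i).differentiableAt (by norm_num)

theorem fderiv_eq_sum_pd {F : EuclideanSpace ℝ (Fin n) → V} (v : EuclideanSpace ℝ (Fin n)) :
    fderiv ℝ F u v = ∑ i, v i • pd i F u := by
  have hx : v = ∑ k, v k • EuclideanSpace.single k (1 : ℝ) := by
    have := (EuclideanSpace.basisFun (Fin n) ℝ).sum_repr v
    simpa using this.symm
  conv_lhs => rw [hx]
  simp [pd]

end PartialDerivatives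

/-! ### Regularity of the normal, Christoffel symbols and the Weingarten equation. -/

section LocalGeometry

variable {n : ℕ} {X η : EuclideanSpace ℝ (Fin n) → Amb n} {u : EuclideanSpace ℝ (Fin n)}

/-- A continuous unit normal of a `C^{k+1}` immersion is of class `C^k`. -/
theorem contDiffAt_normal {k m : ℕ∞ω} (hX : ContDiffAt ℝ m X u) (hk : k + 1 ≤ m)
    (hli : LinearIndependent ℝ fun i => pd i X u) (hη : ContinuousAt η u)
    (hunit : ∀ᶠ w in nhds u, ‖η w‖ = 1)
    (horth : ∀ᶠ w in nhds u, ∀ i, ⟪η w, pd i X w⟫ = 0) : ContDiffAt ℝ k η u := by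
  have hfr : ContDiffAt ℝ k (fun w i => pd i X w) u :=
    contDiffAt_pi.2 fun i => contDiffAt_pd hX hk i
  -- Only the sign of `s` matters, so it is frozen at `u`; continuity of `η` keeps that sign nearby,
  -- and there `η` is the smooth expression `unitNormal s` of the frame.
  set s := detSnoc (fun i => pd i X u) (η u) with hs
  have hs0 : s ≠ 0 := by
    refine detSnoc_ne_zero_of_orth hli ?_ horth.self_of_nhds
    intro h
    have := hunit.self_of_nhds
    simp [h] at this
  have hcont : ContinuousAt (fun w => s * detSnoc (fun i => pd i X w) (η w)) u :=
    continuousAt_const.mul (continuousAt_detSnoc hfr.continuousAt hη)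
  have hpos : ∀ᶠ w in nhds u, 0 < s * detSnoc (fun i => pd i X w) (η w) :=
    hcont.eventually (lt_mem_nhds (mul_self_pos.2 hs0))
  refine ContDiffAt.congr_of_eventuallyEq
    ((contDiffAt_unitNormal (s := s) hs0 hli).comp u (contDiffAt_const.prodMk hfr)) ?_
  filter_upwards [hunit, horth, hpos] with w h1 h2 h3
  exact eq_unitNormal h1 h2 h3

theorem secondFF_symm {N : Amb n} (hX : ContDiffAt ℝ 2 X u) (i j : Fin n) :
    secondFF X N u i j = secondFF X N u j i := by
  simp only [secondFF, Matrix.of_apply, pd_comm hX i j]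

theorem pd_firstFF (hX : ContDiffAt ℝ 2 X u) (i j l : Fin n) :
    pd i (fun w => firstFF X w j l) u =
      ⟪pd j X u, pd i (pd l X) u⟫ + ⟪pd i (pd j X) u, pd l X u⟫ :=
  pd_inner (differentiableAt_pd hX j) (differentiableAt_pd hX l) i

/-- The product rule turns the three metric derivatives into six terms; by symmetry of second
derivatives four cancel and the other two coincide. -/
theorem christoffel_eq (hX : ContDiffAt ℝ 2 X u) (k i j : Fin n) :
    christoffel X k i j u = ∑ l, invFF X u k l * ⟪pd i (pd j X) u, pd l X u⟫ := by
  rw [christoffel, Finset.mul_sum]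
  refine Finset.sum_congr rfl fun l _ => ?_
  rw [pd_firstFF hX, pd_firstFF hX, pd_firstFF hX, pd_comm hX j i, pd_comm hX l i,
    pd_comm hX l j, real_inner_comm (pd i (pd l X) u), real_inner_comm (pd j (pd l X) u)]
  ring

/-- The Weingarten equation. -/
theorem inner_pd_normal (hX : ContDiffAt ℝ 2 X u) (hη : DifferentiableAt ℝ η u)
    (horth : ∀ᶠ w in nhds u, ∀ i, ⟪η w, pd i X w⟫ = 0) (i j : Fin n) :
    ⟪pd i η u, pd j X u⟫ = -secondFF X (η u) u i j := by
  have h := pd_inner hη (differentiableAt_pd hX j) i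
  rw [pd_congr (G := fun _ => (0 : ℝ)) (horth.mono fun w hw => hw j), pd_const] at h
  rw [secondFF, Matrix.of_apply, real_inner_comm]
  rw [real_inner_comm] at h ⊢
  linarith [real_inner_comm (η u) (pd i (pd j X) u)]

theorem inner_pd_self (hη : DifferentiableAt ℝ η u) (hunit : ∀ᶠ w in nhds u, ‖η w‖ = 1)
    (i : Fin n) : ⟪pd i η u, η u⟫ = 0 := by
  have h := pd_inner hη hη i
  rw [pd_congr (G := fun _ => (1 : ℝ)) (hunit.mono fun w hw => by
    simp only [real_inner_self_eq_norm_sq, hw, one_pow]), pd_const,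
    real_inner_comm (η u)] at h
  linarith [real_inner_comm (η u) (pd i η u)]

/-- Obtained by differentiating `⟪pd j η, η⟫ = 0`, which holds on a whole neighbourhood. -/
theorem inner_pd_pd_self (hη : ContDiffAt ℝ 2 η u) (hunit : ∀ᶠ w in nhds u, ‖η w‖ = 1)
    (i j : Fin n) : ⟪pd i (pd j η) u, η u⟫ = -⟪pd i η u, pd j η u⟫ := by
  have hev : ∀ᶠ w in nhds u, ⟪pd j η w, η w⟫ = 0 := by
    filter_upwards [eventually_differentiableAt hη, hunit.eventually_nhds] with w h1 h2
    exact inner_pd_self h1 h2 j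
  have h := pd_inner (differentiableAt_pd hη j) (hη.differentiableAt (by norm_num)) i
  rw [pd_congr (G := fun _ => (0 : ℝ)) hev, pd_const, real_inner_comm (pd i η u)] at h
  linarith [real_inner_comm (pd i η u) (pd j η u)]

end LocalGeometry

/-! ### First variation of the normal and of the mean curvature in coordinates. -/

section Variation

variable {n : ℕ} {X η : EuclideanSpace ℝ (Fin n) → Amb n} {φ : EuclideanSpace ℝ (Fin n) → ℝ}
  {u : EuclideanSpace ℝ (Fin n)}

theorem pd_variation (hX : DifferentiableAt ℝ X u) (hη : DifferentiableAt ℝ η u)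
    (hφ : DifferentiableAt ℝ φ u) (t : ℝ) (i : Fin n) :
    pd i (fun w => X w + (t * φ w) • η w) u =
      pd i X u + t • (pd i φ u • η u + φ u • pd i η u) := by
  have h1 : (fun w => X w + (t * φ w) • η w) = fun w => X w + t • (φ w • η w) := by
    ext1 w; rw [mul_smul]
  rw [h1, pd_add hX ((hφ.fun_smul hη).fun_const_smul t), pd_const_smul t (hφ.fun_smul hη),
    pd_smul hφ hη]

theorem pd_pd_variation (hX : ContDiffAt ℝ 2 X u) (hη : ContDiffAt ℝ 2 η u)
    (hφ : ContDiffAt ℝ 2 φ u) (t : ℝ) (i j : Fin n) :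
    pd i (pd j (fun w => X w + (t * φ w) • η w)) u = pd i (pd j X) u +
      t • ((pd i (pd j φ) u • η u + pd j φ u • pd i η u) +
        (pd i φ u • pd j η u + φ u • pd i (pd j η) u)) := by
  have hev : pd j (fun w => X w + (t * φ w) • η w) =ᶠ[nhds u] fun w =>
      pd j X w + t • (pd j φ w • η w + φ w • pd j η w) := by
    filter_upwards [eventually_differentiableAt hX,
      eventually_differentiableAt hη,
      eventually_differentiableAt hφ] with w h1 h2 h3
    exact pd_variation h1 h2 h3 t j
  have hη1 := hη.differentiableAt (by norm_num)
  have hφ1 := hφ.differentiableAt (by norm_num)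
  have hηj := differentiableAt_pd hη j
  have hφj := differentiableAt_pd hφ j
  rw [pd_congr hev, pd_add (differentiableAt_pd hX j)
      (((hφj.fun_smul hη1).fun_add (hφ1.fun_smul hηj)).fun_const_smul t),
    pd_const_smul t ((hφj.fun_smul hη1).fun_add (hφ1.fun_smul hηj)),
    pd_add (hφj.fun_smul hη1) (hφ1.fun_smul hηj), pd_smul hφj hη1, pd_smul hφ1 hηj]

theorem hasDerivAt_affine {V : Type*} [NormedAddCommGroup V] [NormedSpace ℝ V] (a b : V) :
    HasDerivAt (fun t : ℝ => a + t • b) b 0 := by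
  simpa using ((hasDerivAt_id (0 : ℝ)).smul_const b).const_add a

/-- Infinitesimal variation of the unit normal. -/
theorem deriv_normal_variation (hX : ContDiffAt ℝ 2 X u) (hη : ContDiffAt ℝ 2 η u)
    (hφ : ContDiffAt ℝ 2 φ u) (hli : LinearIndependent ℝ fun i => pd i X u)
    (hunit : ∀ᶠ w in nhds u, ‖η w‖ = 1)
    (horth : ∀ᶠ w in nhds u, ∀ i, ⟪η w, pd i X w⟫ = 0)
    {ν : ℝ → Amb n} {ν' : Amb n} (hν : HasDerivAt ν ν' 0) (hν0 : ν 0 = η u)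
    (hνunit : ∀ᶠ t in nhds (0 : ℝ), ‖ν t‖ = 1)
    (hνorth : ∀ᶠ t in nhds (0 : ℝ), ∀ i,
      ⟪ν t, pd i (fun w => X w + (t * φ w) • η w) u⟫ = 0) :
    ν' = -gradLoc X φ u := by
  have hη1 := hη.differentiableAt (by norm_num)
  have hφ1 := hφ.differentiableAt (by norm_num)
  have hX1 := hX.differentiableAt (by norm_num)
  have hηu : ‖η u‖ = 1 := hunit.self_of_nhds
  have h1 : ⟪ν', η u⟫ = 0 := by
    have h := hν.inner ℝ hν
    have h' : HasDerivAt (fun t => ⟪ν t, ν t⟫) 0 0 :=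
      (hasDerivAt_const (0 : ℝ) (1 : ℝ)).congr_of_eventuallyEq (hνunit.mono fun t ht => by
        simp only [real_inner_self_eq_norm_sq, ht, one_pow])
    have := h.unique h'
    rw [real_inner_comm, hν0] at this
    linarith [real_inner_comm ν' (η u)]
  -- In the derivative of `⟨ν t, ∂ᵢ(Y t)⟩ = 0` the velocity of the frame contributes `⟨η, ∂ᵢφ η + φ
  -- ∂ᵢη⟩ = ∂ᵢφ`.
  have h2 : ∀ i, ⟪ν', pd i X u⟫ = -pd i φ u := by
    intro i
    have h := hν.inner ℝ (hasDerivAt_affine (pd i X u) (pd i φ u • η u + φ u • pd i η u))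
    have h' : HasDerivAt (fun t : ℝ =>
        ⟪ν t, pd i X u + t • (pd i φ u • η u + φ u • pd i η u)⟫) 0 0 :=
      (hasDerivAt_const (0 : ℝ) (0 : ℝ)).congr_of_eventuallyEq (hνorth.mono fun t ht => by
        simp only []
        rw [← pd_variation hX1 hη1 hφ1, ht i])
    have := h.unique h'
    rw [hν0, inner_add_right, inner_smul_right, inner_smul_right, real_inner_self_eq_norm_sq, hηu,
      real_inner_comm, inner_pd_self hη1 hunit] at this
    simp at this
    linarith
  have hη0 : η u ≠ 0 := by rintro h; simp [h] at hηu
  rw [eq_sum_gramMat_inv hli hη0 horth.self_of_nhds h1]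
  simp only [h2, gradLoc, mul_neg, neg_smul, Finset.sum_neg_distrib]
  rfl

/-- This is how the tilting of the normal by `-∇φ` supplies the Christoffel correction that turns
second partial derivatives into the Hessian. -/
theorem inner_gradLoc (hX : ContDiffAt ℝ 2 X u) (i j : Fin n) :
    ⟪pd i (pd j X) u, gradLoc X φ u⟫ = ∑ k, christoffel X k i j u * pd k φ u := by
  simp only [gradLoc, inner_sum, inner_smul_right, christoffel_eq hX, Finset.sum_mul]
  rw [Finset.sum_comm]
  refine Finset.sum_congr rfl fun a _ => Finset.sum_congr rfl fun b _ => ?_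
  rw [show invFF X u b a = invFF X u a b from gramMat_inv_symm _ b a]
  ring

/-- This is the shape in which `|σ|²` arises from the derivative of the inverse metric. -/
theorem sqNormSecondFFLoc_eq_sum_mul {N : Amb n} :
    sqNormSecondFFLoc X N u =
      ∑ i, ∑ j, (invFF X u * secondFF X N u * invFF X u) i j * secondFF X N u i j := by
  simp only [sqNormSecondFFLoc, Matrix.mul_apply, Finset.sum_mul]
  have hP : ∀ a b, invFF X u a b = invFF X u b a := gramMat_inv_symm _
  calc _ = ∑ j, ∑ l, ∑ k, ∑ i, invFF X u i j * invFF X u k l * secondFF X N u i k *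
        secondFF X N u j l := by
        rw [Finset.sum_comm]
        refine Finset.sum_congr rfl fun j _ => ?_
        rw [Finset.sum_comm, Finset.sum_congr rfl fun k _ => Finset.sum_comm, Finset.sum_comm]
    _ = _ := by
        refine Finset.sum_congr rfl fun j _ => Finset.sum_congr rfl fun l _ =>
          Finset.sum_congr rfl fun k _ => Finset.sum_congr rfl fun i _ => ?_
        rw [hP i j]; ring

/-- The derivatives of a unit normal are tangent, so their products expand through the inverse
metric, and the Weingarten equation turns each factor into `-h`: the trace of the third fundamental
form is `|σ|²`. -/
theorem sum_invFF_mul_inner_pd_normal (hX : ContDiffAt ℝ 2 X u) (hη : DifferentiableAt ℝ η u)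
    (hli : LinearIndependent ℝ fun i => pd i X u)
    (hunit : ∀ᶠ w in nhds u, ‖η w‖ = 1)
    (horth : ∀ᶠ w in nhds u, ∀ i, ⟪η w, pd i X w⟫ = 0) :
    ∑ i, ∑ j, invFF X u i j * ⟪pd i η u, pd j η u⟫ = sqNormSecondFFLoc X (η u) u := by
  have hη0 : η u ≠ 0 := by
    rintro h
    have := hunit.self_of_nhds
    simp [h] at this
  unfold sqNormSecondFFLoc
  refine Finset.sum_congr rfl fun i _ => Finset.sum_congr rfl fun j _ => ?_
  rw [inner_eq_sum_gramMat_inv hli hη0 horth.self_of_nhds (inner_pd_self hη hunit i),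
    Finset.sum_comm, Finset.mul_sum]
  refine Finset.sum_congr rfl fun k _ => ?_
  rw [Finset.mul_sum]
  refine Finset.sum_congr rfl fun l _ => ?_
  rw [inner_pd_normal hX hη horth, real_inner_comm, inner_pd_normal hX hη horth,
    gramMat_inv_symm _ l k]
  simp only [invFF, firstFF, gramMat]
  ring

/-- Derivative of the mean curvature of a normal variation, in coordinates. -/
theorem hasDerivAt_meanCurvLoc (hX : ContDiffAt ℝ 2 X u) (hη : ContDiffAt ℝ 2 η u)
    (hφ : ContDiffAt ℝ 2 φ u) (hli : LinearIndependent ℝ fun i => pd i X u)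
    (hunit : ∀ᶠ w in nhds u, ‖η w‖ = 1)
    (horth : ∀ᶠ w in nhds u, ∀ i, ⟪η w, pd i X w⟫ = 0)
    {ν : ℝ → Amb n} (hν : HasDerivAt ν (-gradLoc X φ u) 0) (hν0 : ν 0 = η u) :
    HasDerivAt (fun t => meanCurvLoc (fun w => X w + (t * φ w) • η w) (ν t) u)
      ((1 / (n : ℝ)) * (laplaceLoc X φ u + sqNormSecondFFLoc X (η u) u * φ u)) 0 := by
  have hη1 := hη.differentiableAt (by norm_num)
  have hφ1 := hφ.differentiableAt (by norm_num)
  have hX1 := hX.differentiableAt (by norm_num)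
  have hηu : ‖η u‖ = 1 := hunit.self_of_nhds
  set S := secondFF X (η u) u with hS
  set P := invFF X u with hP
  let Y : ℝ → EuclideanSpace ℝ (Fin n) → Amb n := fun t w => X w + (t * φ w) • η w
  have hY0 : Y 0 = X := by ext1 w; simp [Y]
  -- The `∂φ η` part of the velocity is orthogonal to the frame; the `φ ∂η` part gives `-φh` once
  -- from each factor.
  have hG : ∀ i j, HasDerivAt (fun t => firstFF (Y t) u i j) (((-2 * φ u) • S) i j) 0 := by
    intro i j
    have h := (hasDerivAt_affine (pd i X u) (pd i φ u • η u + φ u • pd i η u)).inner ℝ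
      (hasDerivAt_affine (pd j X u) (pd j φ u • η u + φ u • pd j η u))
    have hfun : (fun t => firstFF (Y t) u i j) = fun t : ℝ =>
        ⟪pd i X u + t • (pd i φ u • η u + φ u • pd i η u),
          pd j X u + t • (pd j φ u • η u + φ u • pd j η u)⟫ := by
      ext1 t
      simp only [firstFF, Matrix.of_apply, Y, pd_variation hX1 hη1 hφ1]
    rw [hfun]
    refine h.congr_deriv ?_
    have o := horth.self_of_nhds
    have e1 := inner_pd_normal hX hη1 horth i j
    have e2 := inner_pd_normal hX hη1 horth j i
    rw [secondFF_symm hX j i] at e2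
    simp only [zero_smul, add_zero, inner_add_right, inner_add_left, inner_smul_right,
      inner_smul_left, o, e1, real_inner_comm (pd j η u), real_inner_comm (η u), e2,
      Matrix.smul_apply, smul_eq_mul, conj_trivial]
    rw [hS]
    ring
  have hdet : (firstFF (Y 0) u).det ≠ 0 := by
    rw [hY0]; exact det_gramMat_ne_zero hli
  have hinv := hasDerivAt_matrix_inv hG hdet
  -- Terms with a single derivative of `η` vanish against `η`; the moving normal gives the
  -- Christoffel sum, and `⟨∂ᵢ∂ⱼη, η⟩` gives the last term.
  have hsec : ∀ i j, HasDerivAt (fun t => secondFF (Y t) (ν t) u i j)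
      (pd i (pd j φ) u - ∑ k, christoffel X k i j u * pd k φ u
        - φ u * ⟪pd i η u, pd j η u⟫) 0 := by
    intro i j
    have h := (hasDerivAt_affine (pd i (pd j X) u)
      ((pd i (pd j φ) u • η u + pd j φ u • pd i η u) +
        (pd i φ u • pd j η u + φ u • pd i (pd j η) u))).inner ℝ hν
    have hfun : (fun t => secondFF (Y t) (ν t) u i j) = fun t : ℝ =>
        ⟪pd i (pd j X) u + t • ((pd i (pd j φ) u • η u + pd j φ u • pd i η u) +
        (pd i φ u • pd j η u + φ u • pd i (pd j η) u)), ν t⟫ := by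
      ext1 t
      simp only [secondFF, Matrix.of_apply, Y, pd_pd_variation hX hη hφ]
    rw [hfun]
    refine h.congr_deriv ?_
    rw [zero_smul, add_zero, inner_neg_right, inner_gradLoc hX, hν0]
    simp only [inner_add_left, inner_smul_left, conj_trivial, inner_pd_self hη1 hunit,
      inner_pd_pd_self hη hunit, real_inner_self_eq_norm_sq, hηu]
    ring
  have hsum : HasDerivAt (fun t => ∑ i, ∑ j, invFF (Y t) u i j * secondFF (Y t) (ν t) u i j)
      (∑ i, ∑ j, ((-((firstFF (Y 0) u)⁻¹ * ((-2 * φ u) • S) * (firstFF (Y 0) u)⁻¹)) i j *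
        secondFF (Y 0) (ν 0) u i j + invFF (Y 0) u i j *
        (pd i (pd j φ) u - ∑ k, christoffel X k i j u * pd k φ u
        - φ u * ⟪pd i η u, pd j η u⟫))) 0 :=
    HasDerivAt.fun_sum fun i _ => HasDerivAt.fun_sum fun j _ => (hinv i j).mul (hsec i j)
  have hfin := hsum.const_mul (1 / (n : ℝ))
  refine hfin.congr_deriv ?_
  congr 1
  rw [hY0, hν0]
  have hA := sqNormSecondFFLoc_eq_sum_mul (X := X) (u := u) (N := η u)
  have hB := sum_invFF_mul_inner_pd_normal hX hη1 hli hunit horth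
  -- The inverse metric contributes `2φ|σ|²` and the second fundamental form `-φ|σ|²`, which leaves
  -- `φ|σ|²`.
  calc _ = ∑ i, ∑ j, ((2 * φ u) * ((P * S * P) i j * S i j) +
        (P i j * (pd i (pd j φ) u - ∑ k, christoffel X k i j u * pd k φ u)
          - φ u * (P i j * ⟪pd i η u, pd j η u⟫))) := by
        refine Finset.sum_congr rfl fun i _ => Finset.sum_congr rfl fun j _ => ?_
        have : -((firstFF X u)⁻¹ * ((-2 * φ u) • S) * (firstFF X u)⁻¹) =
            (2 * φ u) • (P * S * P) := by
          rw [Matrix.mul_smul, Matrix.smul_mul, ← neg_smul, hP, invFF]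
          congr 1; ring
        rw [this, Matrix.smul_apply, smul_eq_mul]
        ring
    _ = (2 * φ u) * sqNormSecondFFLoc X (η u) u + (laplaceLoc X φ u -
          φ u * sqNormSecondFFLoc X (η u) u) := by
        simp only [Finset.sum_add_distrib, Finset.sum_sub_distrib, ← Finset.mul_sum]
        rw [← hA, hB, laplaceLoc]
    _ = _ := by ring

end Variation

/-! ### Passing between the manifold and its charts. -/

section Charts

variable {n : ℕ} {M : Type*} [TopologicalSpace M] [ChartedSpace (EuclideanSpace ℝ (Fin n)) M]
  {V : Type*} [NormedAddCommGroup V] [NormedSpace ℝ V]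

theorem inChart_apply_extChartAt {W : Type*} (F : M → W) {p q : M}
    (hq : q ∈ (chartAt (EuclideanSpace ℝ (Fin n)) p).source) :
    inChart (n := n) F p (extChartAt (𝓡 n) p q) = F q := by
  rw [inChart, (extChartAt (𝓡 n) p).left_inv (by rwa [extChartAt_source])]

theorem contDiffAt_inChart {k : ℕ∞ω} {F : M → V} {p : M}
    (hF : ContMDiffAt (𝓡 n) 𝓘(ℝ, V) k F p) :
    ContDiffAt ℝ k (inChart (n := n) F p) (coordAt (n := n) p) := by
  have := (contMDiffAt_iff.1 hF).2
  rw [ModelWithCorners.range_eq_univ, contDiffWithinAt_univ] at this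
  exact this

theorem contMDiffAt_of_inChart {k : ℕ∞ω} {F : M → V} {p : M} (hc : ContinuousAt F p)
    (hF : ContDiffAt ℝ k (inChart (n := n) F p) (coordAt (n := n) p)) :
    ContMDiffAt (𝓡 n) 𝓘(ℝ, V) k F p := by
  refine contMDiffAt_iff.2 ⟨hc, ?_⟩
  rw [ModelWithCorners.range_eq_univ, contDiffWithinAt_univ]
  exact hF

theorem differentiableAt_inChart {F : M → V} {p : M}
    (hF : MDifferentiableAt (𝓡 n) 𝓘(ℝ, V) F p) :
    DifferentiableAt ℝ (inChart (n := n) F p) (coordAt (n := n) p) := by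
  have := (mdifferentiableAt_iff _ _).1 hF |>.2
  rw [ModelWithCorners.range_eq_univ, differentiableWithinAt_univ] at this
  exact this

theorem eventually_mem_target (p : M) :
    ∀ᶠ u in nhds (coordAt (n := n) p), u ∈ (extChartAt (𝓡 n) p).target :=
  extChartAt_target_mem_nhds p

/-- A property of the points near `p` read in the chart. -/
theorem eventually_chart {p : M} {Q : M → EuclideanSpace ℝ (Fin n) → Prop}
    (h : ∀ q ∈ (chartAt (EuclideanSpace ℝ (Fin n)) p).source, Q q (extChartAt (𝓡 n) p q)) :
    ∀ᶠ u in nhds (coordAt (n := n) p), Q ((extChartAt (𝓡 n) p).symm u) u := by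
  filter_upwards [eventually_mem_target p] with u hu
  have h1 := h ((extChartAt (𝓡 n) p).symm u) (by
    rw [← extChartAt_source (𝓡 n)]; exact (extChartAt (𝓡 n) p).map_target hu)
  rwa [(extChartAt (𝓡 n) p).right_inv hu] at h1

/-- The coordinate frame of the chart at `p`, at a point `q` of its domain. -/
theorem exists_chart_frame [IsManifold (𝓡 n) 1 M] {p q : M}
    (hq : q ∈ (chartAt (EuclideanSpace ℝ (Fin n)) p).source) :
    ∃ e : Module.Basis (Fin n) ℝ (TangentSpace (𝓡 n) q),
      ∀ F : M → V, MDifferentiableAt (𝓡 n) 𝓘(ℝ, V) F q →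
        ∀ i, pd i (inChart (n := n) F p) (extChartAt (𝓡 n) p q) = mvfderiv (𝓡 n) F q (e i) := by
  have hqs : q ∈ (extChartAt (𝓡 n) p).source := by rwa [extChartAt_source]
  set z := extChartAt (𝓡 n) p q with hz
  have hzt : z ∈ (extChartAt (𝓡 n) p).target := (extChartAt (𝓡 n) p).map_source hqs
  have hzq : (extChartAt (𝓡 n) p).symm z = q := (extChartAt (𝓡 n) p).left_inv hqs
  have hinv := isInvertible_mfderivWithin_extChartAt_symm hzt
  have hd := mdifferentiableWithinAt_extChartAt_symm hzt
  rw [ModelWithCorners.range_eq_univ] at hinv hd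
  rw [mfderivWithin_univ] at hinv
  rw [mdifferentiableWithinAt_univ] at hd
  obtain ⟨A, hA⟩ := hinv
  -- The basis is the image of the standard one under the derivative of the inverse chart. It is
  -- built before `F` is given, so one frame serves `ψ` and all its variations.
  let e : Module.Basis (Fin n) ℝ (TangentSpace (𝓡 n) q) :=
    (EuclideanSpace.basisFun (Fin n) ℝ).toBasis.map A.toLinearEquiv
  have he : ∀ i, e i = A (EuclideanSpace.single i (1 : ℝ)) := fun i => by
    change A ((EuclideanSpace.basisFun (Fin n) ℝ).toBasis i) = _
    rw [OrthonormalBasis.coe_toBasis, EuclideanSpace.basisFun_apply]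
  refine ⟨e, fun F hF i => ?_⟩
  have hF' : MDifferentiableAt (𝓡 n) 𝓘(ℝ, V) F ((extChartAt (𝓡 n) p).symm z) := by rwa [hzq]
  have hc := mfderiv_comp z hF' hd
  have h1 : fderiv ℝ (inChart (n := n) F p) z = mfderiv 𝓘(ℝ, EuclideanSpace ℝ (Fin n)) 𝓘(ℝ, V)
    (F ∘ (extChartAt (𝓡 n) p).symm) z := by
    rw [mfderiv_eq_fderiv]; rfl
  rw [pd, h1, hc, ← hA, hzq, he]
  rfl

end Charts

/-! ### The spherical gradient and the chain rule on the sphere. -/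

section Sphere

variable {n : ℕ}

/-- The stereographic chart extends to a map of the ambient space. -/
theorem exists_extension_extChartAt (q : Sph n) : ∃ ρ : Amb n → EuclideanSpace ℝ (Fin n),
    DifferentiableAt ℝ ρ q ∧ ∀ x : Sph n, extChartAt (𝓡 n) q x = ρ x := by
  have := Fact.mk (@finrank_euclideanSpace_fin ℝ _ (n + 1))
  let U := (OrthonormalBasis.fromOrthogonalSpanSingleton (𝕜 := ℝ)
        n (ne_zero_of_mem_unit_sphere (-q))).repr
  -- The chart at `q` projects from the antipode `-q`; its formula is smooth where the product with
  -- `-q` differs from `1`, and at `q` that product is `-1`.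
  refine ⟨fun x => U (stereoToFun ((-q : Sph n) : Amb n) x), ?_, fun x => ?_⟩
  · refine U.differentiable.differentiableAt.comp _ ?_
    refine (contDiffOn_stereoToFun (n := 1)).differentiableOn (by norm_num) |>.differentiableAt ?_
    refine IsOpen.mem_nhds ?_ ?_
    · exact isOpen_ne_fun (by fun_prop) (by fun_prop)
    · have : ⟪((-q : Sph n) : Amb n), (q : Amb n)⟫ = -1 := by
        simp
      simp
      norm_num
  · rfl

theorem mdifferentiableAt_coe (q : Sph n) :
    MDifferentiableAt (𝓡 n) 𝓘(ℝ, Amb n) (Subtype.val : Sph n → Amb n) q := by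
  have := Fact.mk (@finrank_euclideanSpace_fin ℝ _ (n + 1))
  exact (contMDiff_coe_sphere (E := Amb n) (m := 1) q).mdifferentiableAt (by norm_num)

theorem linearIndependent_pd_coe (q : Sph n) :
    LinearIndependent ℝ fun i =>
      pd i (inChart (n := n) (Subtype.val : Sph n → Amb n) q) (coordAt (n := n) q) := by
  have := Fact.mk (@finrank_euclideanSpace_fin ℝ _ (n + 1))
  have : IsManifold (𝓡 n) 1 (Sph n) := IsManifold.of_le (n := ω) le_top
  obtain ⟨e, he⟩ := exists_chart_frame (V := Amb n) (mem_chart_source (EuclideanSpace ℝ (Fin n)) q)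
  have : (fun i => pd i (inChart (n := n) (Subtype.val : Sph n → Amb n) q) (coordAt (n := n) q)) =
      (mvfderiv (𝓡 n) (Subtype.val : Sph n → Amb n) q).toLinearMap ∘ e :=
    funext fun i => he _ (mdifferentiableAt_coe q) i
  rw [this]
  exact e.linearIndependent.map' _ (LinearMap.ker_eq_bot.2
    (injective_mvfderiv_subtypeVal_sphere q))

/-- The inclusion has constant norm, so its partial derivatives, and hence the gradient, are
orthogonal to the position vector. -/
theorem inner_grad_coe (H : Sph n → ℝ) (q : Sph n) :
    ⟪grad (M := Sph n) Subtype.val H q, (q : Amb n)⟫ = 0 := by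
  have hd := differentiableAt_inChart (mdifferentiableAt_coe q)
  have h : ∀ i,
      ⟪pd i (inChart (n := n) (Subtype.val : Sph n → Amb n) q) (coordAt (n := n) q), (q : Amb n)⟫ = 0 := by
    intro i
    have := inner_pd_self hd (Filter.Eventually.of_forall fun w => by simp [inChart]) i
    rwa [coordAt, inChart_apply_extChartAt _ (mem_chart_source _ q)] at this
  simp [grad, gradLoc, sum_inner, inner_smul_left, h]

/-- Chain rule for a function on the sphere along a curve, with the spherical gradient. -/
theorem hasDerivAt_comp_curve {H : Sph n → ℝ} {c : ℝ → Sph n} {v : Amb n} {t : ℝ}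
    (hH : MDifferentiableAt (𝓡 n) 𝓘(ℝ, ℝ) H (c t))
    (hc : HasDerivAt (fun s => (c s : Amb n)) v t) :
    HasDerivAt (fun s => H (c s)) ⟪grad (M := Sph n) Subtype.val H (c t), v⟫ t := by
  set q := c t with hq
  set Z := inChart (n := n) (Subtype.val : Sph n → Amb n) q with hZ
  obtain ⟨ρ, hρ, hρφ⟩ := exists_extension_extChartAt q
  have hcont : ContinuousAt c t := by
    exact Topology.IsInducing.subtypeVal.continuousAt_iff.2 hc.continuousAt
  have hsrc : ∀ᶠ s in nhds t, c s ∈ (chartAt (EuclideanSpace ℝ (Fin n)) q).source :=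
    hcont.eventually
      ((chartAt (EuclideanSpace ℝ (Fin n)) q).open_source.mem_nhds (mem_chart_source _ q))
  -- The curve is differentiable only as an ambient curve; the ambient extension `ρ` of the chart is
  -- what gives its coordinates a derivative.
  have hy : HasDerivAt (fun s => ρ (c s)) (fderiv ℝ ρ q v) t :=
    hρ.hasFDerivAt.comp_hasDerivAt_of_eq t hc rfl
  set y' := fderiv ℝ ρ q v with hy'
  have hy0 : ρ (c t) = coordAt (n := n) q := (hρφ q).symm
  have hZd : HasDerivAt (fun s => Z (ρ (c s))) (fderiv ℝ Z (coordAt (n := n) q) y') t :=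
    (differentiableAt_inChart (mdifferentiableAt_coe q)).hasFDerivAt.comp_hasDerivAt_of_eq t hy
      hy0.symm
  have hv : v = fderiv ℝ Z (coordAt (n := n) q) y' :=
    hc.unique (hZd.congr_of_eventuallyEq (hsrc.mono fun s hs => by
      simp only []
      rw [← hρφ, hZ, inChart_apply_extChartAt _ hs]))
  have hHd : HasDerivAt (fun s => inChart (n := n) H q (ρ (c s)))
      (fderiv ℝ (inChart (n := n) H q) (coordAt (n := n) q) y') t :=
    (differentiableAt_inChart hH).hasFDerivAt.comp_hasDerivAt_of_eq t hy hy0.symm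
  -- The velocity is the image of `y'` under the derivative of `Z`, and the gradient pairs with each
  -- `∂ᵢZ` to give `∂ᵢH`.
  have hval : ⟪grad (M := Sph n) Subtype.val H q, v⟫ =
      fderiv ℝ (inChart (n := n) H q) (coordAt (n := n) q) y' := by
    rw [hv, fderiv_eq_sum_pd, fderiv_eq_sum_pd, inner_sum]
    refine Finset.sum_congr rfl fun i _ => ?_
    rw [inner_smul_right, smul_eq_mul]
    congr 1
    exact inner_sum_gramMat_inv (linearIndependent_pd_coe q)
      (fun j => pd j (inChart (n := n) H q) (coordAt (n := n) q)) i
  rw [hval]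
  refine hHd.congr_of_eventuallyEq (hsrc.mono fun s hs => ?_)
  simp only []
  rw [← hρφ, inChart_apply_extChartAt _ hs]

end Sphere

/-! ### Testing linear maps on a basis. -/

section Frames

variable {n : ℕ} {T : Type*} [AddCommGroup T] [Module ℝ T]

theorem linearIndependent_frame_iff (e : Module.Basis (Fin n) ℝ T) (L : T →ₗ[ℝ] Amb n) :
    LinearIndependent ℝ (fun i => L (e i)) ↔ Function.Injective L := by
  refine ⟨fun h => ?_, fun h => e.linearIndependent.map' L (LinearMap.ker_eq_bot.2 h)⟩
  refine (injective_iff_map_eq_zero L).2 fun v hv => ?_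
  rw [← e.sum_repr v, map_sum] at hv
  simp only [map_smul] at hv
  have := Fintype.linearIndependent_iff.1 h _ hv
  rw [← e.sum_repr v]
  simp [this]

theorem inner_eq_zero_of_frame (e : Module.Basis (Fin n) ℝ T) (L : T →ₗ[ℝ] Amb n) {x : Amb n}
    (h : ∀ i, ⟪x, L (e i)⟫ = 0) (v : T) : ⟪x, L v⟫ = 0 := by
  rw [← e.sum_repr v, map_sum, inner_sum]
  refine Finset.sum_eq_zero fun i _ => ?_
  rw [map_smul, inner_smul_right, h, mul_zero]

end Frames

/-! ### Normal variations of immersed hypersurfaces: immersion, unit normal and first variation. -/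

section Hypersurfaces

variable {n : ℕ} {M : Type*} [TopologicalSpace M] [ChartedSpace (EuclideanSpace ℝ (Fin n)) M]
  {ψ : M → Amb n} {η : M → Sph n} {f : M → ℝ} {t : ℝ}

theorem norm_coe_sph (x : Sph n) : ‖(x : Amb n)‖ = 1 := by simp

theorem coe_sph_ne_zero (x : Sph n) : (x : Amb n) ≠ 0 := by
  intro h
  have := norm_coe_sph x
  simp [h] at this

theorem IsOrientedHypersurface.mdifferentiableAt {k : ℕ∞} (h : IsOrientedHypersurface k ψ η)
    (hk : 1 ≤ k) (p : M) : MDifferentiableAt (𝓡 n) 𝓘(ℝ, Amb n) ψ p :=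
  h.contMDiff.mdifferentiableAt (by
    have : (k : ℕ∞ω) ≠ 0 := by
      rintro h0
      have : k = 0 := by exact_mod_cast h0
      simp [this] at hk
    exact this)

theorem SameOrientation.of_frame (e : ∀ p : M, Module.Basis (Fin n) ℝ (TangentSpace (𝓡 n) p))
    {φ : M → Amb n} {ν : M → Sph n}
    (h : ∀ p, 0 < detSnoc (fun i => mvfderiv (𝓡 n) ψ p (e p i)) (η p) *
      detSnoc (fun i => mvfderiv (𝓡 n) φ p (e p i)) (ν p)) :
    SameOrientation ψ η φ ν := fun p _ hv =>
  detSnoc_mul_detSnoc_pos (e p) (L := (mvfderiv (𝓡 n) ψ p).toLinearMap)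
    (L' := (mvfderiv (𝓡 n) φ p).toLinearMap) (h p) hv

/-- The normal compatible with the orientation is given by the cross product of any frame. -/
theorem coe_eq_unitNormal {φ : M → Amb n} {ν : M → Sph n}
    (hν : ∀ (p : M) (v : TangentSpace (𝓡 n) p), ⟪(ν p : Amb n), mvfderiv (𝓡 n) φ p v⟫ = 0)
    (h : SameOrientation ψ η φ ν) (p : M)
    (e : Module.Basis (Fin n) ℝ (TangentSpace (𝓡 n) p)) :
    (ν p : Amb n) = unitNormal (detSnoc (fun i => mvfderiv (𝓡 n) ψ p (e i)) (η p))
      (fun i => mvfderiv (𝓡 n) φ p (e i)) :=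
  eq_unitNormal (norm_coe_sph _) (fun i => hν p (e i)) (h p e e.linearIndependent)

theorem IsOrientedHypersurface.detSnoc_ne_zero {k : ℕ∞} (h : IsOrientedHypersurface k ψ η) (p : M)
    (b : Module.Basis (Fin n) ℝ (TangentSpace (𝓡 n) p)) :
    detSnoc (fun i => mvfderiv (𝓡 n) ψ p (b i)) (η p) ≠ 0 :=
  detSnoc_ne_zero_of_orth
    ((linearIndependent_frame_iff b (mvfderiv (𝓡 n) ψ p).toLinearMap).2 (h.immersion p))
    (coe_sph_ne_zero _) fun _ => h.normal p _

theorem continuousAt_pd_chart {F : EuclideanSpace ℝ (Fin n) → Amb n} {p : M}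
    (hF : ContDiffAt ℝ 2 F (extChartAt (𝓡 n) p p)) :
    ContinuousAt (fun q i => pd i F (extChartAt (𝓡 n) p q)) p :=
  continuousAt_pi.2 fun i => ContinuousAt.comp (f := extChartAt (𝓡 n) p)
    (differentiableAt_pd hF i).continuousAt (continuousAt_extChartAt (I := 𝓡 n) p)

variable [IsManifold (𝓡 n) 1 M]

theorem IsOrientedHypersurface.linearIndependent_pd {k : ℕ∞} (h : IsOrientedHypersurface k ψ η)
    (hk : 1 ≤ k) (p : M) :
    LinearIndependent ℝ fun i => pd i (inChart (n := n) ψ p) (coordAt (n := n) p) := by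
  obtain ⟨e, he⟩ := exists_chart_frame (V := Amb n) (mem_chart_source (EuclideanSpace ℝ (Fin n)) p)
  have : (fun i => pd i (inChart (n := n) ψ p) (coordAt (n := n) p)) =
      fun i => mvfderiv (𝓡 n) ψ p (e i) := funext fun i => he _ (h.mdifferentiableAt hk p) i
  rw [this]
  exact (linearIndependent_frame_iff e (mvfderiv (𝓡 n) ψ p).toLinearMap).2 (h.immersion p)

theorem IsOrientedHypersurface.eventually_orth {k : ℕ∞} (h : IsOrientedHypersurface k ψ η)
    (hk : 1 ≤ k) (p : M) : ∀ᶠ u in nhds (coordAt (n := n) p), ∀ i,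
      ⟪inChart (n := n) (fun q => (η q : Amb n)) p u, pd i (inChart (n := n) ψ p) u⟫ = 0 := by
  refine eventually_chart (n := n) (p := p)
    (Q := fun q u => ∀ i, ⟪(η q : Amb n), pd i (inChart (n := n) ψ p) u⟫ = 0) fun q hq i => ?_
  obtain ⟨e, he⟩ := exists_chart_frame (V := Amb n) hq
  rw [he _ (h.mdifferentiableAt hk q)]
  exact h.normal q _

/-- The unit normal of a `C³` hypersurface is of class `C²`. -/
theorem IsOrientedHypersurface.contMDiff_normal (h : IsOrientedHypersurface 3 ψ η) :
    ContMDiff (𝓡 n) 𝓘(ℝ, Amb n) 2 fun p => (η p : Amb n) := by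
  intro p
  have hc : Continuous fun p => (η p : Amb n) := continuous_subtype_val.comp h.continuous_normal
  refine contMDiffAt_of_inChart hc.continuousAt ?_
  refine contDiffAt_normal (m := 3) (contDiffAt_inChart (h.contMDiff p)) (by norm_num)
    (h.linearIndependent_pd (by norm_num) p) ?_
    (Filter.Eventually.of_forall fun u => norm_coe_sph _) (h.eventually_orth (by norm_num) p)
  exact hc.continuousAt.comp (continuousAt_extChartAt_symm (I := 𝓡 n) p)

theorem contMDiff_normalVariation (h : IsOrientedHypersurface 3 ψ η)
    (hf : ContMDiff (𝓡 n) 𝓘(ℝ, ℝ) 2 f) (t : ℝ) :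
    ContMDiff (𝓡 n) 𝓘(ℝ, Amb n) 2 (normalVariation ψ η f t) := by
  have h1 : ContMDiff (𝓡 n) 𝓘(ℝ, Amb n) 2 ψ := h.contMDiff.of_le (by norm_num)
  exact h1.add ((contMDiff_const.mul hf).smul h.contMDiff_normal)

theorem mdifferentiableAt_normalVariation (h : IsOrientedHypersurface 3 ψ η)
    (hf : ContMDiff (𝓡 n) 𝓘(ℝ, ℝ) 2 f) (t : ℝ) (p : M) :
    MDifferentiableAt (𝓡 n) 𝓘(ℝ, Amb n) (normalVariation ψ η f t) p :=
  (contMDiff_normalVariation h hf t).mdifferentiableAt (by norm_num)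

/-- Near a given point, the normal variations are immersions for small times. -/
theorem eventually_immersion (h : IsOrientedHypersurface 3 ψ η)
    (hf : ContMDiff (𝓡 n) 𝓘(ℝ, ℝ) 2 f) (p : M) :
    ∀ᶠ a : ℝ × M in nhds (0, p),
      Function.Injective (mvfderiv (𝓡 n) (normalVariation ψ η f a.1) a.2) := by
  set X := inChart (n := n) ψ p
  set N := inChart (n := n) (fun q => (η q : Amb n)) p
  set φ := inChart (n := n) f p
  set u := coordAt (n := n) p
  have hX : ContDiffAt ℝ 2 X u := contDiffAt_inChart ((h.contMDiff p).of_le (by norm_num))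
  have hN : ContDiffAt ℝ 2 N u := contDiffAt_inChart (h.contMDiff_normal p)
  have hφ : ContDiffAt ℝ 2 φ u := contDiffAt_inChart (hf p)
  let w : ℝ × EuclideanSpace ℝ (Fin n) → Fin n → Amb n := fun b i =>
    pd i X b.2 + b.1 • (pd i φ b.2 • N b.2 + φ b.2 • pd i N b.2)
  have hw : ContinuousAt w (0, u) := by
    refine continuousAt_pi.2 fun i => ?_
    have c2 : ContinuousAt (fun b : ℝ × EuclideanSpace ℝ (Fin n) => b.2) (0, u) := continuousAt_snd
    have cc : ∀ {W : Type} [TopologicalSpace W] {g : EuclideanSpace ℝ (Fin n) → W},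
        ContinuousAt g u → ContinuousAt (fun b : ℝ × EuclideanSpace ℝ (Fin n) => g b.2) (0, u) :=
      fun hg => ContinuousAt.comp (x := ((0 : ℝ), u)) hg c2
    exact (cc (differentiableAt_pd hX i).continuousAt).add
      (continuousAt_fst.smul (((cc (differentiableAt_pd hφ i).continuousAt).smul
        (cc hN.continuousAt)).add ((cc hφ.continuousAt).smul
          (cc (differentiableAt_pd hN i).continuousAt))))
  have hw0 : cross (w (0, u)) ≠ 0 := by
    have : w (0, u) = fun i => pd i X u := by ext1 i; simp [w]
    rw [this]
    exact cross_ne_zero (h.linearIndependent_pd (by norm_num) p)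
  -- A nonvanishing cross product encodes independence of the frame as an open condition, jointly in
  -- time and position.
  have hev : ∀ᶠ b in nhds ((0 : ℝ), u), cross (w b) ≠ 0 :=
    ((contDiff_cross (k := 0)).continuous.continuousAt.comp hw).eventually_ne hw0
  have hmap : Filter.Tendsto (fun a : ℝ × M => (a.1, extChartAt (𝓡 n) p a.2)) (nhds (0, p))
      (nhds (0, u)) :=
    (continuousAt_fst.prodMk (ContinuousAt.comp (x := ((0 : ℝ), p))
      (continuousAt_extChartAt (I := 𝓡 n) p) continuousAt_snd)).tendsto
  have hsnd : ∀ {Q : M → Prop}, (∀ᶠ q in nhds p, Q q) → ∀ᶠ a : ℝ × M in nhds (0, p), Q a.2 :=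
    fun hQ => (continuousAt_snd (p := ((0 : ℝ), p))).eventually hQ
  have hdiff := (continuousAt_extChartAt (I := 𝓡 n) p).eventually
    ((eventually_differentiableAt hX).and
      ((eventually_differentiableAt hN).and (eventually_differentiableAt hφ)))
  filter_upwards [hmap.eventually hev, hsnd hdiff,
    hsnd ((chartAt (EuclideanSpace ℝ (Fin n)) p).open_source.mem_nhds (mem_chart_source _ p))]
    with a ha hd hq
  obtain ⟨e, he⟩ := exists_chart_frame (V := Amb n) hq
  refine (linearIndependent_frame_iff e
    (mvfderiv (𝓡 n) (normalVariation ψ η f a.1) a.2).toLinearMap).1 ?_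
  have : (fun i => (mvfderiv (𝓡 n) (normalVariation ψ η f a.1) a.2).toLinearMap (e i)) =
      w (a.1, extChartAt (𝓡 n) p a.2) := by
    ext1 i
    refine (he _ (mdifferentiableAt_normalVariation h hf a.1 a.2) i).symm.trans ?_
    exact pd_variation hd.1 hd.2.1 hd.2.2 a.1 i
  rw [this]
  exact linearIndependent_of_cross_ne_zero ha

/-- Compactly supported normal variations are immersions for small times. -/
theorem exists_pos_immersion (h : IsOrientedHypersurface 3 ψ η)
    (hf : ContMDiff (𝓡 n) 𝓘(ℝ, ℝ) 2 f) (hfc : HasCompactSupport f) :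
    ∃ ε > 0, ∀ t : ℝ, |t| < ε →
      ∀ p, Function.Injective (mvfderiv (𝓡 n) (normalVariation ψ η f t) p) := by
  -- The joint neighbourhoods of the points `(0, p)` give a uniform time because the support is
  -- compact.
  have hK : ∀ᶠ t : ℝ in nhds 0, ∀ p ∈ tsupport f,
      Function.Injective (mvfderiv (𝓡 n) (normalVariation ψ η f t) p) :=
    hfc.isCompact.eventually_forall_of_forall_eventually fun p _ => eventually_immersion h hf p
  obtain ⟨ε, hε, hball⟩ := Metric.eventually_nhds_iff.1 hK
  refine ⟨ε, hε, fun t ht p => ?_⟩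
  by_cases hp : p ∈ tsupport f
  · exact hball (by simpa using ht) p hp
  -- Off the support nothing moves near `p`, whatever the time.
  · have hev : normalVariation ψ η f t =ᶠ[nhds p] ψ := by
      filter_upwards [notMem_tsupport_iff_eventuallyEq.1 hp] with q hq
      simp [normalVariation, hq]
    have : ∀ v, mvfderiv (𝓡 n) (normalVariation ψ η f t) p v = mvfderiv (𝓡 n) ψ p v := fun v =>
      congrArg (fun L : TangentSpace (𝓡 n) p →L[ℝ] Amb n => L v) hev.mfderiv_eq
    intro v v' hvv
    rw [this, this] at hvv
    exact h.immersion p hvv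

/-- A unit normal of a normal variation compatible with the orientation is continuous. -/
theorem continuous_of_sameOrientation (h : IsOrientedHypersurface 3 ψ η)
    (hf : ContMDiff (𝓡 n) 𝓘(ℝ, ℝ) 2 f) {t : ℝ}
    (ht : ∀ p, Function.Injective (mvfderiv (𝓡 n) (normalVariation ψ η f t) p)) {ν : M → Sph n}
    (horth : ∀ (p : M) (v : TangentSpace (𝓡 n) p),
      ⟪(ν p : Amb n), mvfderiv (𝓡 n) (normalVariation ψ η f t) p v⟫ = 0)
    (hor : SameOrientation ψ η (normalVariation ψ η f t) ν) : Continuous ν := by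
  set φ := normalVariation ψ η f t with hφ
  have hψd := h.mdifferentiableAt (by norm_num)
  have hφd := mdifferentiableAt_normalVariation h hf t
  refine continuous_iff_continuousAt.2 fun p => ?_
  refine Topology.IsInducing.subtypeVal.continuousAt_iff.2 ?_
  obtain ⟨e, he⟩ := exists_chart_frame (V := Amb n) (mem_chart_source (EuclideanSpace ℝ (Fin n)) p)
  set X := inChart (n := n) ψ p with hX
  set Y := inChart (n := n) φ p with hY
  have hXc : ContinuousAt (fun q i => pd i X (extChartAt (𝓡 n) p q)) p :=
    continuousAt_pd_chart (contDiffAt_inChart ((h.contMDiff p).of_le (by norm_num)))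
  have hYc : ContinuousAt (fun q i => pd i Y (extChartAt (𝓡 n) p q)) p :=
    continuousAt_pd_chart (contDiffAt_inChart (contMDiff_normalVariation h hf t p))
  have hηc : ContinuousAt (fun q => (η q : Amb n)) p :=
    (continuous_subtype_val.comp h.continuous_normal).continuousAt
  have hXp : (fun i => pd i X (extChartAt (𝓡 n) p p)) = fun i => mvfderiv (𝓡 n) ψ p (e i) :=
    funext fun i => he _ (hψd p) i
  have hYp : (fun i => pd i Y (extChartAt (𝓡 n) p p)) = fun i => mvfderiv (𝓡 n) φ p (e i) :=
    funext fun i => he _ (hφd p) i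
  -- The coordinate frame of the single chart at `p` varies continuously, and at each nearby `q` it
  -- is the image of a basis of the tangent space, so `coe_eq_unitNormal` identifies this expression
  -- with `ν q`.
  have hU := continuousAt_unitNormal (continuousAt_detSnoc hXc hηc) hYc
    (by rw [hXp]; exact h.detSnoc_ne_zero p e)
    (by
      rw [hYp]
      exact (linearIndependent_frame_iff e (mvfderiv (𝓡 n) φ p).toLinearMap).2 (ht p))
  refine hU.congr ?_
  filter_upwards [(chartAt (EuclideanSpace ℝ (Fin n)) p).open_source.mem_nhds
    (mem_chart_source _ p)] with q hq
  obtain ⟨b, hb⟩ := exists_chart_frame (V := Amb n) hq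
  have hbX : (fun i => pd i X (extChartAt (𝓡 n) p q)) = fun i => mvfderiv (𝓡 n) ψ q (b i) :=
    funext fun i => hb _ (hψd q) i
  have hbY : (fun i => pd i Y (extChartAt (𝓡 n) p q)) = fun i => mvfderiv (𝓡 n) φ q (b i) :=
    funext fun i => hb _ (hφd q) i
  rw [hbX, hbY]
  exact (coe_eq_unitNormal horth hor q b).symm

/-- An immersed normal variation has a unique unit normal compatible with the orientation. -/
theorem existsUnique_isVariationNormal (h : IsOrientedHypersurface 3 ψ η)
    (hf : ContMDiff (𝓡 n) 𝓘(ℝ, ℝ) 2 f) {t : ℝ}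
    (ht : ∀ p, Function.Injective (mvfderiv (𝓡 n) (normalVariation ψ η f t) p)) :
    ∃! ν : M → Sph n, IsVariationNormal ψ η f t ν := by
  -- These bases are chosen pointwise with no continuity in `p`; continuity of the resulting normal
  -- is recovered from its compatibility with the orientation.
  choose e he using fun p : M =>
    exists_chart_frame (V := Amb n) (mem_chart_source (EuclideanSpace ℝ (Fin n)) p)
  set φ := normalVariation ψ η f t with hφ
  have hli : ∀ (p : M) (b : Module.Basis (Fin n) ℝ (TangentSpace (𝓡 n) p)),
      LinearIndependent ℝ fun i => mvfderiv (𝓡 n) φ p (b i) := fun p b =>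
    (linearIndependent_frame_iff b (mvfderiv (𝓡 n) φ p).toLinearMap).2 (ht p)
  have hs := h.detSnoc_ne_zero
  let ν : M → Sph n := fun p => ⟨unitNormal (detSnoc (fun i => mvfderiv (𝓡 n) ψ p (e p i)) (η p))
      (fun i => mvfderiv (𝓡 n) φ p (e p i)), by
    rw [mem_sphere_zero_iff_norm]
    exact norm_unitNormal (hs p _) (hli p _)⟩
  have horth : ∀ (p : M) (v : TangentSpace (𝓡 n) p),
      ⟪(ν p : Amb n), mvfderiv (𝓡 n) φ p v⟫ = 0 := fun p v =>
    inner_eq_zero_of_frame (e p) (mvfderiv (𝓡 n) φ p).toLinearMap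
      (fun i => inner_unitNormal _ (fun i => mvfderiv (𝓡 n) φ p (e p i)) i) v
  have hor : SameOrientation ψ η φ ν :=
    SameOrientation.of_frame e fun p => mul_detSnoc_unitNormal_pos (hs p _) (hli p _)
  have hcm := contMDiff_normalVariation h hf t
  have hcont := continuous_of_sameOrientation h hf ht horth hor
  refine ⟨ν, ⟨⟨hcm, ht, horth, hcont⟩, hor⟩, fun ν' hν' => funext fun p => Subtype.ext ?_⟩
  rw [coe_eq_unitNormal hν'.1.normal hν'.2 p (e p)]

/-- The image of the differential has dimension `n` and is orthogonal to `η p`, so it is the whole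
orthogonal complement. -/
theorem mem_range_of_inner_normal (h : IsOrientedHypersurface 3 ψ η) {p : M} {x : Amb n}
    (hx : ⟪x, (η p : Amb n)⟫ = 0) : x ∈ Set.range (mvfderiv (𝓡 n) ψ p) := by
  obtain ⟨e, -⟩ := exists_chart_frame (V := Amb n) (mem_chart_source (EuclideanSpace ℝ (Fin n)) p)
  have hmem := mem_span_of_orth
    ((linearIndependent_frame_iff e (mvfderiv (𝓡 n) ψ p).toLinearMap).2 (h.immersion p))
    (coe_sph_ne_zero _) (fun i => h.normal p (e i)) hx
  have hle : Submodule.span ℝ (Set.range fun i => (mvfderiv (𝓡 n) ψ p).toLinearMap (e i)) ≤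
      LinearMap.range (mvfderiv (𝓡 n) ψ p).toLinearMap :=
    Submodule.span_le.2 (by rintro _ ⟨i, rfl⟩; exact ⟨e i, rfl⟩)
  obtain ⟨v, hv⟩ := hle hmem
  exact ⟨v, hv⟩

/-- The tangent spaces of the sphere at `η p` and of the hypersurface at `p` are both the complement
of `η p`. -/
theorem fieldX_mem_range (h : IsOrientedHypersurface 3 ψ η) (𝓗 : Sph n → ℝ) (p : M) :
    fieldX 𝓗 η p ∈ Set.range (mvfderiv (𝓡 n) ψ p) := by
  refine mem_range_of_inner_normal h ?_
  rw [fieldX, inner_smul_left, inner_grad_coe, mul_zero]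

/-- The normal of a variation moves along minus the gradient. -/
theorem hasDerivAt_variation_normal (h : IsOrientedHypersurface 3 ψ η)
    (hf : ContMDiff (𝓡 n) 𝓘(ℝ, ℝ) 2 f) {ηt : ℝ → M → Sph n}
    (hηt : ∀ᶠ t in nhds (0 : ℝ), IsVariationNormal ψ η f t (ηt t)) (p : M) :
    ηt 0 p = η p ∧ HasDerivAt (fun t => (ηt t p : Amb n)) (-grad ψ f p) 0 := by
  obtain ⟨e, he⟩ := exists_chart_frame (V := Amb n) (mem_chart_source (EuclideanSpace ℝ (Fin n)) p)
  set X := inChart (n := n) ψ p with hXdef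
  set N := inChart (n := n) (fun q => (η q : Amb n)) p with hNdef
  set φ := inChart (n := n) f p with hφdef
  set u := coordAt (n := n) p with hu
  have hX : ContDiffAt ℝ 2 X u := contDiffAt_inChart ((h.contMDiff p).of_le (by norm_num))
  have hN : ContDiffAt ℝ 2 N u := contDiffAt_inChart (h.contMDiff_normal p)
  have hφ : ContDiffAt ℝ 2 φ u := contDiffAt_inChart (hf p)
  have hli : LinearIndependent ℝ fun i => pd i X u := h.linearIndependent_pd (by norm_num) p
  have hNu : N u = η p := inChart_apply_extChartAt _ (mem_chart_source _ p)
  set s := detSnoc (fun i => mvfderiv (𝓡 n) ψ p (e i)) (η p) with hs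
  have heX : (fun i => pd i X u) = fun i => mvfderiv (𝓡 n) ψ p (e i) :=
    funext fun i => he _ (h.mdifferentiableAt (by norm_num) p) i
  have hs0 : s ≠ 0 := h.detSnoc_ne_zero p e
  let w : ℝ → Fin n → Amb n := fun t i => pd i X u + t • (pd i φ u • N u + φ u • pd i N u)
  have hpdw : ∀ t i, pd i (fun y => X y + (t * φ y) • N y) u = w t i := fun t i =>
    pd_variation (hX.differentiableAt (by norm_num)) (hN.differentiableAt (by norm_num))
      (hφ.differentiableAt (by norm_num)) t i
  have hmv : ∀ t i, mvfderiv (𝓡 n) (normalVariation ψ η f t) p (e i) = w t i := fun t i =>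
    (he _ (mdifferentiableAt_normalVariation h hf t p) i).symm.trans (hpdw t i)
  -- No regularity in `t` is assumed of `ηt`; it is forced to equal this expression, smooth in `t`
  -- near `0`, in which `s` is constant because it depends only on `ψ` and `η`.
  have hform : ∀ᶠ t in nhds (0 : ℝ), (ηt t p : Amb n) = unitNormal s (w t) := by
    filter_upwards [hηt] with t ht
    rw [coe_eq_unitNormal ht.1.normal ht.2 p e]
    simp only [hmv, ← hs]
  have hw0 : w 0 = fun i => pd i X u := by ext1 i; simp [w]
  have h0 : (ηt 0 p : Amb n) = η p := by
    rw [hform.self_of_nhds, hw0, eq_comm, heX]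
    exact eq_unitNormal (norm_coe_sph _) (fun i => h.normal p (e i)) (mul_self_pos.2 hs0)
  have hwd : DifferentiableAt ℝ w 0 :=
    differentiableAt_pi.2 fun i => (hasDerivAt_affine _ _).differentiableAt
  have hU : DifferentiableAt ℝ (fun t => unitNormal s (w t)) 0 :=
    differentiableAt_unitNormal hs0 hwd (by rw [hw0]; exact hli)
  have hder : HasDerivAt (fun t => (ηt t p : Amb n)) (deriv (fun t => unitNormal s (w t)) 0) 0 :=
    hU.hasDerivAt.congr_of_eventuallyEq hform
  refine ⟨Subtype.ext h0, hder.congr_deriv ?_⟩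
  refine deriv_normal_variation hX hN hφ hli
    (Filter.Eventually.of_forall fun y => norm_coe_sph _) (h.eventually_orth (by norm_num) p) hder
    (h0.trans hNu.symm) (Filter.Eventually.of_forall fun t => norm_coe_sph _) ?_
  filter_upwards [hηt] with t ht i
  rw [hpdw, ← hmv]
  exact ht.1.normal p (e i)

/-- The first variation of the mean curvature. -/
theorem hasDerivAt_meanCurvature (h : IsOrientedHypersurface 3 ψ η)
    (hf : ContMDiff (𝓡 n) 𝓘(ℝ, ℝ) 2 f) {ηt : ℝ → M → Sph n}
    (hηt : ∀ᶠ t in nhds (0 : ℝ), IsVariationNormal ψ η f t (ηt t)) (p : M) :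
    HasDerivAt (fun t => meanCurvature (normalVariation ψ η f t) (ηt t) p)
      ((1 / (n : ℝ)) * (laplacian ψ f p + sqNormSecondFF ψ η p * f p)) 0 := by
  obtain ⟨h0, hd⟩ := hasDerivAt_variation_normal h hf hηt p
  have hNu : inChart (n := n) (fun q => (η q : Amb n)) p (coordAt (n := n) p) = η p :=
    inChart_apply_extChartAt _ (mem_chart_source _ p)
  have hfu : inChart (n := n) f p (coordAt (n := n) p) = f p :=
    inChart_apply_extChartAt _ (mem_chart_source _ p)
  have key := hasDerivAt_meanCurvLoc (ν := fun t => (ηt t p : Amb n))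
    (contDiffAt_inChart ((h.contMDiff p).of_le (by norm_num)))
    (contDiffAt_inChart (h.contMDiff_normal p)) (contDiffAt_inChart (hf p))
    (h.linearIndependent_pd (by norm_num) p)
    (Filter.Eventually.of_forall fun y => norm_coe_sph _) (h.eventually_orth (by norm_num) p) hd
    ((congrArg Subtype.val h0).trans hNu.symm)
  rw [hNu, hfu] at key
  exact key

end Hypersurfaces

end HHyp

/-! ### The linearization formula. -/

theorem proposition4p1 {n : ℕ} (hn : 1 ≤ n)
    {M : Type*} [TopologicalSpace M] [ChartedSpace (EuclideanSpace ℝ (Fin n)) M]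
    [IsManifold (𝓡 n) 3 M]
    (𝓗 : HHyp.Sph n → ℝ) (h𝓗 : ContMDiff (𝓡 n) 𝓘(ℝ, ℝ) 1 𝓗)
    (ψ : M → HHyp.Amb n) (η : M → HHyp.Sph n) (hψ : HHyp.IsHHypersurface 𝓗 ψ η)
    (f : M → ℝ) (hf : ContMDiff (𝓡 n) 𝓘(ℝ, ℝ) 2 f) (hfc : HasCompactSupport f) :
    -- for small `t` the normal variation is an immersed hypersurface with a unique unit normal
    (∃ ε > 0, ∀ t : ℝ, |t| < ε → ∃! ν : M → HHyp.Sph n, HHyp.IsVariationNormal ψ η f t ν) ∧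
    -- the field `X_𝓗` is tangent to the hypersurface
    (∀ p, HHyp.fieldX 𝓗 η p ∈ Set.range (mvfderiv (𝓡 n) ψ p)) ∧
    -- the linearization formula, at every point
    ∀ ηt : ℝ → M → HHyp.Sph n,
      (∀ᶠ t in nhds (0 : ℝ), HHyp.IsVariationNormal ψ η f t (ηt t)) →
      ∀ p : M,
        DifferentiableAt ℝ (fun t : ℝ =>
          HHyp.meanCurvature (HHyp.normalVariation ψ η f t) (ηt t) p - 𝓗 (ηt t p)) 0 ∧
        (n : ℝ) * deriv (fun t : ℝ =>
          HHyp.meanCurvature (HHyp.normalVariation ψ η f t) (ηt t) p - 𝓗 (ηt t p)) 0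
          = HHyp.stabilityOp 𝓗 ψ η f p := by
  have : IsManifold (𝓡 n) 1 M := IsManifold.of_le (n := 3) (by norm_num)
  have h := hψ.oriented
  refine ⟨?_, fun p => HHyp.fieldX_mem_range h 𝓗 p, fun ηt hηt p => ?_⟩
  · obtain ⟨ε, hε, hi⟩ := HHyp.exists_pos_immersion h hf hfc
    exact ⟨ε, hε, fun t ht => HHyp.existsUnique_isVariationNormal h hf (hi t ht)⟩
  · obtain ⟨h0, hd⟩ := HHyp.hasDerivAt_variation_normal h hf hηt p
    -- The normal moves with velocity `-∇f`, so subtracting this derivative gives `⟨X_𝓗, ∇f⟩` with a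
    -- plus sign once multiplied by `n`.
    have hH := HHyp.hasDerivAt_comp_curve (c := fun t => ηt t p)
      ((h𝓗 (ηt 0 p)).mdifferentiableAt (by norm_num)) hd
    have hmain := (HHyp.hasDerivAt_meanCurvature h hf hηt p).sub hH
    refine ⟨hmain.differentiableAt, ?_⟩
    have hn0 : (n : ℝ) ≠ 0 := by positivity
    refine (congrArg (fun a => (n : ℝ) * a) hmain.deriv).trans ?_
    simp only [h0, HHyp.stabilityOp, HHyp.fieldX, inner_neg_right, inner_smul_left, conj_trivial]
    field_simp
    ring
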